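/- Let $F$ be a non-archimedean local field with ring of integers $\mathfrak o_F$ and maximal ideal $\mathfrak p_F$, let $D$ be a finite-dimensional division algebra with centre $F$, and let $m\ge 1$. Let $G=\mathrm{GL}_m(D)$ and let $G_{\mathrm{der}}=\ker(\mathrm{Nrd}:G\to F^\times)$ be the kernel of the reduced norm (an inner form of $\mathrm{SL}_n(F)$, where $n=m\sqrt{[D:F]}$). Let $(\pi,V)$ be an irreducible smooth complex representation of $G_{\mathrm{der}}$. *Moy--Prasad depth.* Let $v$ be the valuation of $D$ with $v(F^\times)=\mathbb Z$ (and $v(0)=\infty$). For a point $x=(x_1,\dots,x_m)$ of the standard apartment $\mathbb R^m$ of the (extended) Bruhat--Tits building $\mathcal B(G)$ and $r\ge 0$, the Moy--Prasad group $P_{x,r}\subset G$ is generated by the diagonal matrices $\mathrm{diag}(t_1,\dots,t_m)$ with $v(t_i)=0$ and $v(t_i-1)\ge r$ for all $i$, and by the matrices $1+cE_{ij}$ with $i\ne j$ and $v(c)+x_i-x_j\ge r$. A general point of $\mathcal B(G)$ is of the form $gx$ with $g\in G$ and $x$ in the standard apartment, and $P_{gx,r}=gP_{x,r}g^{-1}$.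 Put $P_{y,r+}=\bigcup_{s>r}P_{y,s}$ and $P'_{y,r+}=P_{y,r+}\cap G_{\mathrm{der}}$. The Moy--Prasad depth $d_{\mathrm{MP}}(\pi)$ is the minimum of all real $r\ge 0$ such that $V^{P'_{y,r+}}\neq 0$ for some $y\in\mathcal B(G)$. *Normalized level.* For a hereditary $\mathfrak o_F$-order $\mathfrak A$ in $\mathrm M_m(D)$ with Jacobson radical $\mathfrak P$, let $e_F(\mathfrak A)$ be the integer with $\mathfrak p_F\mathfrak A=\mathfrak P^{e_F(\mathfrak A)}$, and put $U^j(\mathfrak A)=1+\mathfrak P^j$ for $j\ge 1$ and $U^j(\mathfrak A)'=U^j(\mathfrak A)\cap G_{\mathrm{der}}$. The normalized level of $\pi$ is $$d(\pi)=\min\{\,j/e_F(\mathfrak A)\,\},$$ where $(j,\mathfrak A)$ ranges over all pairs of an integer $j\ge 0$ and a hereditary $\mathfrak o_F$-order $\mathfrak A$ in $\mathrm M_m(D)$ such that $V^{U^{j+1}(\mathfrak A)'}\ne 0$, i.e. $\pi$ contains the trivial character of $U^{j+1}(\mathfrak A)'$. Then both minima exist, and $d_{\mathrm{MP}}(\pi)=d(\pi)$.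 -/

import Mathlib

open ValuativeRel TensorProduct

noncomputable section

namespace InnerFormSL

/-- The group `GL_m(D)` of invertible `m × m` matrices over the division ring `D`. -/
abbrev GLD (D : Type*) [DivisionRing D] (m : ℕ) : Type _ := (Matrix (Fin m) (Fin m) D)ˣ

section Valuation

variable (F : Type*) [Field F] [ValuativeRel F] [TopologicalSpace F]
  [IsNonarchimedeanLocalField F]
variable {D : Type*} [DivisionRing D] [Algebra F D]

/-- The additive valuation of the local field `F`, normalized to have image `ℤ` on `Fˣ`
(meaningful for nonzero arguments only). -/
def ordF (a : F) : ℤ :=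
  -WithZero.log (IsNonarchimedeanLocalField.valueGroupWithZeroIsoInt F (valuation F a))

/-- The unique extension of `ordF` to a valuation of the finite dimensional division algebra `D`:
`v(a) = ord (N_{D/F} a) / [D : F]` (meaningful for nonzero arguments only).
On `F` it is `ordF`, so that it maps `Fˣ` onto `ℤ`. -/
def valD (a : D) : ℝ := (ordF F (Algebra.norm F a) : ℝ) / (Module.finrank F D : ℝ)

/-- The fractional ideal `{a ∈ D | v(a) ≥ s}` of `D`, where `v(0) = ∞`. -/
def ballD (s : ℝ) : Set D := {a | a = 0 ∨ s ≤ valD F a}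

end Valuation

section DerivedGroup

variable (F : Type*) [Field F] (D : Type*) [DivisionRing D] [Algebra F D] (m : ℕ)

/-- The reduced norm of `M_m(D)` on `GL_m(D)`, with values in an algebraic closure of `F`, computed
by means of a splitting `φ` of `M_m(D)` over that algebraic closure: `g ↦ det φ(1 ⊗ g)`.
(By the Skolem-Noether theorem it does not depend on `φ`.) -/
def reducedNorm {n : ℕ}
    (φ : AlgebraicClosure F ⊗[F] Matrix (Fin m) (Fin m) D ≃ₐ[AlgebraicClosure F]
      Matrix (Fin n) (Fin n) (AlgebraicClosure F)) :
    GLD D m →* AlgebraicClosure F where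
  toFun g := (φ (1 ⊗ₜ[F] (g : Matrix (Fin m) (Fin m) D))).det
  map_one' := by
    rw [Units.val_one, ← Algebra.TensorProduct.one_def, map_one, Matrix.det_one]
  map_mul' g h := by
    rw [← Matrix.det_mul, ← map_mul, Algebra.TensorProduct.tmul_mul_tmul, one_mul, Units.val_mul]

/-- `GL_m(D)_der`: the kernel of the reduced norm of `GL_m(D)`. -/
def derivedGL : Subgroup (GLD D m) :=
  ⨅ (n : ℕ) (φ : AlgebraicClosure F ⊗[F] Matrix (Fin m) (Fin m) D ≃ₐ[AlgebraicClosure F]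
      Matrix (Fin n) (Fin n) (AlgebraicClosure F)), (reducedNorm F D m φ).ker

end DerivedGroup

section Representations

/-- A representation of a topological group is smooth if the stabilizer of every vector is open. -/
def IsSmooth {H : Type*} [Group H] [TopologicalSpace H] {V : Type*} [AddCommGroup V] [Module ℂ V]
    (π : Representation ℂ H V) : Prop :=
  ∀ v : V, IsOpen {h : H | π h v = v}

/-- For a representation `π` of a subgroup `H` of `G` and a subset `K` of `G`: there is a nonzero
vector fixed by `K ∩ H`. (When `K` is a subgroup: `π` contains the trivial representation
of `K ∩ H`.) -/
def HasFixedVector {G : Type*} [Group G] {H : Subgroup G} {V : Type*} [AddCommGroup V] [Module ℂ V]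
    (π : Representation ℂ H V) (K : Set G) : Prop :=
  ∃ v : V, v ≠ 0 ∧ ∀ h : H, (h : G) ∈ K → π h v = v

end Representations

section MoyPrasad

variable (F : Type*) [Field F] [ValuativeRel F] [TopologicalSpace F]
  [IsNonarchimedeanLocalField F]
variable (D : Type*) [DivisionRing D] [Algebra F D] {m : ℕ}

/-- The subgroup `U_{a,s}` (`a = e_i - e_j`, `i ≠ j`) of the root subgroup `U_a ≅ D` of `GL_m(D)`,
relative to the diagonal maximal `F`-split torus: matrices `1 + c E_{ij}` with `v(c) ≥ s`. -/
def rootFiltration (i j : Fin m) (s : ℝ) : Set (GLD D m) :=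
  {g | ∃ c ∈ ballD F (D := D) s,
    (g : Matrix (Fin m) (Fin m) D) = 1 + Matrix.single i j c}

/-- The Moy-Prasad filtration of the minimal Levi subgroup `(Dˣ)^m` of diagonal matrices: for
`r = 0` all entries are units of the maximal order of `D`, and for `r > 0` moreover all entries
`t` satisfy `v(t - 1) ≥ r`. -/
def leviFiltration (r : ℝ) : Set (GLD D m) :=
  {g | ∃ t : Fin m → D, (g : Matrix (Fin m) (Fin m) D) = Matrix.diagonal t ∧
    ∀ i, t i ≠ 0 ∧ valD F (t i) = 0 ∧ t i - 1 ∈ ballD F (D := D) r}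

/-- The Moy-Prasad group `P_{x,r}` (`r ≥ 0`) for a point `x` of the standard apartment `ℝ^m`
of the (extended) Bruhat-Tits building of `GL_m(D)`: the subgroup generated by the `r`-th
filtration subgroup of the minimal Levi subgroup and by the affine root subgroups `U_ψ`,
`ψ = a + k`, with `ψ(x) = a(x) + k ≥ r`. Here `a(x) = x_i - x_j` if `a = e_i - e_j`. -/
def moyPrasadStd (x : Fin m → ℝ) (r : ℝ) : Subgroup (GLD D m) :=
  Subgroup.closure
    (leviFiltration F D r ∪
      ⋃ (i : Fin m) (j : Fin m) (_ : i ≠ j), rootFiltration F D i j (r - (x i - x j)))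

/-- The Moy-Prasad group `P_{y,r}` for the point `y = g • x` of the Bruhat-Tits building, where
`g ∈ GL_m(D)` and `x` lies in the standard apartment. Every point of the building is of this
form, and `P_{g • x, r} = g P_{x,r} g⁻¹`. -/
def moyPrasad (g : GLD D m) (x : Fin m → ℝ) (r : ℝ) : Subgroup (GLD D m) :=
  (moyPrasadStd F D x r).map (MulAut.conj g).toMonoidHom

/-- `P_{y,r+}`, the union of the decreasing family of groups `P_{y,s}` with `s > r`. -/
def moyPrasadPlus (g : GLD D m) (x : Fin m → ℝ) (r : ℝ) : Set (GLD D m) :=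
  ⋃ (s : ℝ) (_ : r < s), (moyPrasad F D g x s : Set (GLD D m))

end MoyPrasad

section HereditaryOrders

variable (F : Type*) [Field F] [ValuativeRel F]
variable {D : Type*} [DivisionRing D] [Algebra F D] {m : ℕ}

/-- `A` is a hereditary `𝔬_F`-order in `M_m(D)`: a subring which is a full `𝔬_F`-lattice
and all of whose left ideals are projective. -/
structure IsHereditaryOrder (A : Subalgebra 𝒪[F] (Matrix (Fin m) (Fin m) D)) : Prop where
  fg : (Subalgebra.toSubmodule A).FG
  span_eq_top : Submodule.span F (A : Set (Matrix (Fin m) (Fin m) D)) = ⊤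
  projective : ∀ I : Ideal A, Module.Projective A I

/-- `e = e_F(A)` is the integer with `𝔭_F A = 𝔓^e`, where `𝔓` is the Jacobson radical of `A`. -/
def IsRamificationIndex (A : Subalgebra 𝒪[F] (Matrix (Fin m) (Fin m) D)) (e : ℕ) : Prop :=
  Ideal.map (algebraMap 𝒪[F] A) 𝓂[F] = Ring.jacobson A ^ e

/-- `U^0(A) = Aˣ` and `U^j(A) = 1 + 𝔓^j` for `j ≥ 1`, as subsets of `GL_m(D)`. -/
def unitFiltration (A : Subalgebra 𝒪[F] (Matrix (Fin m) (Fin m) D)) : ℕ → Set (GLD D m)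
  | 0 => {g | (g : Matrix (Fin m) (Fin m) D) ∈ A ∧
      ((g⁻¹ : GLD D m) : Matrix (Fin m) (Fin m) D) ∈ A}
  | j + 1 => {g | ∃ a : A, a ∈ Ring.jacobson A ^ (j + 1) ∧
      (g : Matrix (Fin m) (Fin m) D) = 1 + (a : Matrix (Fin m) (Fin m) D)}

end HereditaryOrders

section Depth

variable (F : Type*) [Field F] [ValuativeRel F] [TopologicalSpace F]
  [IsNonarchimedeanLocalField F]
variable {D : Type*} [DivisionRing D] [Algebra F D] {m : ℕ}
variable {V : Type*} [AddCommGroup V] [Module ℂ V]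

/-- The set of all `r ≥ 0` such that, for some point `y` of the Bruhat-Tits building, `π` has
nonzero vectors fixed by `P'_{y,r+} = P_{y,r+} ∩ GL_m(D)_der`. -/
def moyPrasadSet (π : Representation ℂ (derivedGL F D m) V) : Set ℝ :=
  {r | 0 ≤ r ∧ ∃ (g : GLD D m) (x : Fin m → ℝ), HasFixedVector π (moyPrasadPlus F D g x r)}

/-- The Moy-Prasad depth of `π`. -/
def moyPrasadDepth (π : Representation ℂ (derivedGL F D m) V) : ℝ := sInf (moyPrasadSet F π)

/-- The set of all `j / e_F(A)`, where `j ≥ 0` is an integer and `A` is a hereditary `𝔬_F`-order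
in `M_m(D)` such that `π` contains the trivial character of `U^{j+1}(A) ∩ GL_m(D)_der`. -/
def levelSet (π : Representation ℂ (derivedGL F D m) V) : Set ℝ :=
  {s | ∃ (A : Subalgebra 𝒪[F] (Matrix (Fin m) (Fin m) D)) (e j : ℕ),
    IsHereditaryOrder F A ∧ IsRamificationIndex F A e ∧
    HasFixedVector π (unitFiltration F A (j + 1)) ∧ s = (j : ℝ) / (e : ℝ)}

/-- The normalized level of `π`. -/
def normalizedLevel (π : Representation ℂ (derivedGL F D m) V) : ℝ := sInf (levelSet F π)

end Depth

end InnerFormSL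

end

/-!
By compactness, `valD` agrees up to a bounded error with the valuation given by the largest
coordinate in an `F`-basis of `D`; applied to the powers `(1 + a)^k`, this yields the ultrametric
inequality, so `valD` is a valuation of `D`.
Gaussian elimination then identifies `P_{x,s}`, for `s > 0`, with `1 + 𝔞_{x,s}`, where `𝔞_{x,s}`
is the lattice of matrices `a` with `v(a_ij) + x_i - x_j ≥ s`.

Every hereditary order `A` stabilizes a periodic chain of lattices in the space of columns: any
two `A`-lattices in it are comparable. Such a chain is the family of balls of a norm, which is
split by a basis, i.e. comes from a point `y` of the building; this gives
`P_{y,(j/e)+} ⊆ U^{j+1}(A)`. Conversely, for a point `y` and `r ≥ 0`, moving `y` to a point whose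
coordinates are equally spaced modulo the value group of `D` produces a hereditary order `A` and
`j / e_F(A) ≤ r` with `U^{j+1}(A) ⊆ P_{y,r+}`. As `e_F(A)` takes only finitely many values here,
the levels that occur have a common denominator, so that the minimum is attained.
-/

noncomputable section

namespace InnerFormSL

open WithZero IsNonarchimedeanLocalField

section LocalField

variable {F : Type*} [Field F] [ValuativeRel F] [TopologicalSpace F]
  [IsNonarchimedeanLocalField F]

variable (F) in
/-- The canonical valuation of the local field `F`, with its value group identified with `ℤᵐ⁰`;
it is the multiplicative form of `ordF`. -/
def valF : Valuation F ℤᵐ⁰ :=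
  (valuation F).map (.ofClass (valueGroupWithZeroIsoInt F))
    (valueGroupWithZeroIsoInt F).strictMono.monotone

lemma valF_apply (a : F) : valF F a = valueGroupWithZeroIsoInt F (valuation F a) := rfl

lemma valF_lt_valF_iff {a b : F} : valF F a < valF F b ↔ valuation F a < valuation F b :=
  (valueGroupWithZeroIsoInt F).strictMono.lt_iff_lt

lemma ordF_eq_neg_log (a : F) : ordF F a = -log (valF F a) := rfl

lemma valF_eq_exp {a : F} (ha : a ≠ 0) : valF F a = exp (-ordF F a) := by
  rw [ordF_eq_neg_log, neg_neg, exp_log ((Valuation.ne_zero_iff _).2 ha)]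

lemma ordF_mul {a b : F} (ha : a ≠ 0) (hb : b ≠ 0) : ordF F (a * b) = ordF F a + ordF F b := by
  simp only [ordF_eq_neg_log, map_mul]
  rw [log_mul ((Valuation.ne_zero_iff _).2 ha) ((Valuation.ne_zero_iff _).2 hb), neg_add]

@[simp] lemma ordF_one : ordF F 1 = 0 := by simp [ordF_eq_neg_log]

lemma ordF_pow (a : F) (n : ℕ) : ordF F (a ^ n) = n * ordF F a := by
  simp [ordF_eq_neg_log, log_pow]

lemma ordF_inv (a : F) : ordF F a⁻¹ = -ordF F a := by simp [ordF_eq_neg_log, log_inv]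

lemma ordF_zpow (a : F) (n : ℤ) : ordF F (a ^ n) = n * ordF F a := by
  simp [ordF_eq_neg_log, log_zpow]

variable (F) in
lemma exists_ordF_eq (k : ℤ) : ∃ a : F, a ≠ 0 ∧ ordF F a = k := by
  obtain ⟨a, ha⟩ := valuation_surjective ((valueGroupWithZeroIsoInt F).symm (exp (-k)))
  have hval : valF F a = exp (-k) := by simp [valF_apply, ha]
  refine ⟨a, fun h0 => exp_ne_zero (hval.symm.trans ?_), by simp [ordF_eq_neg_log, hval]⟩
  rw [h0, map_zero]

/-- The fractional ideal `𝔭_F ^ k = {a ∈ F | ord a ≥ k}`, where `ord 0 = ∞`. -/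
def ballF (k : ℤ) : AddSubgroup F := (valF F).leAddSubgroup (exp (-k))

lemma mem_ballF {a : F} {k : ℤ} : a ∈ ballF k ↔ a = 0 ∨ k ≤ ordF F a := by
  change valF F a ≤ exp (-k) ↔ _
  by_cases ha : a = 0
  · simp [ha]
  · rw [valF_eq_exp ha, exp_le_exp, neg_le_neg_iff, or_iff_right ha]

lemma ballF_antitone : Antitone (ballF (F := F)) := fun _ _ hkl _ ha =>
  mem_ballF.2 ((mem_ballF.1 ha).imp_right hkl.trans)

lemma mul_mem_ballF {a b : F} {k l : ℤ} (ha : a ∈ ballF k) (hb : b ∈ ballF l) :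
    a * b ∈ ballF (k + l) := by
  rcases mem_ballF.1 ha with rfl | ha'
  · simp
  rcases mem_ballF.1 hb with rfl | hb'
  · simp
  by_cases h0 : a = 0 ∨ b = 0
  · exact mem_ballF.2 (.inl (mul_eq_zero.2 h0))
  rw [not_or] at h0
  exact mem_ballF.2 (.inr (by rw [ordF_mul h0.1 h0.2]; exact add_le_add ha' hb'))

lemma mem_ballF_zero {a : F} : a ∈ ballF 0 ↔ a ∈ 𝒪[F] := by
  rw [Valuation.mem_integer_iff, ← (valueGroupWithZeroIsoInt F).strictMono.le_iff_le, map_one]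
  change valF F a ≤ _ ↔ _
  rw [neg_zero, exp_zero, valF_apply]

lemma mem_maximalIdeal_iff {t : 𝒪[F]} : t ∈ 𝓂[F] ↔ (t : F) ∈ ballF 1 := by
  rw [IsLocalRing.mem_maximalIdeal, mem_nonunits_iff,
    (Valuation.integer.integers (valuation F)).isUnit_iff_valuation_eq_one, ← Ne, ← t.2.lt_iff_ne,
    ← (valueGroupWithZeroIsoInt F).strictMono.lt_iff_lt, map_one]
  change valF F t < _ ↔ valF F t ≤ _
  by_cases ht : (t : F) = 0
  · simp [ht]
  rw [valF_eq_exp ht, ← exp_zero, exp_lt_exp, exp_le_exp]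
  omega

lemma isOpen_ballF (k : ℤ) : IsOpen (ballF (F := F) k : Set F) := by
  obtain ⟨c, hc, hck⟩ := exists_ordF_eq F k
  refine (ballF k).isOpen_of_mem_nhds (g := 0) ?_
  refine IsValuativeTopology.mem_nhds_iff.2
    ⟨Units.mk0 (valuation F c) ((Valuation.ne_zero_iff _).2 hc), ?_⟩
  rintro _ ⟨z, hz, rfl⟩
  change valF F (0 + z) ≤ _
  rw [zero_add]
  rw [← hck, ← valF_eq_exp hc]
  exact (valF_lt_valF_iff.2 hz).le

lemma isCompact_ballF_zero : IsCompact (ballF (F := F) 0 : Set F) := by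
  convert IsNonarchimedeanLocalField.isCompact_closedBall F 1 using 1
  ext x
  exact mem_ballF_zero

lemma exists_ballF_subset {s : Set F} (hs : s ∈ nhds (0 : F)) :
    ∃ k : ℤ, (ballF (F := F) k : Set F) ⊆ s := by
  obtain ⟨γ, hγ⟩ := IsValuativeTopology.mem_nhds_iff.1 hs
  obtain ⟨c, hc⟩ := valuation_surjective (γ : ValueGroupWithZero F)
  have hc0 : c ≠ 0 := (Valuation.ne_zero_iff (valuation F)).1 (hc ▸ γ.ne_zero)
  refine ⟨ordF F c + 1, fun a ha => hγ ⟨a, ?_, zero_add a⟩⟩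
  have hac : valF F a < valF F c :=
    lt_of_le_of_lt ha (by rw [valF_eq_exp hc0, exp_lt_exp]; omega)
  exact hc ▸ valF_lt_valF_iff.1 hac

lemma exists_forall_mem_ballF_of_isCompact {X : Type*} [TopologicalSpace X] {K : Set X}
    (hK : IsCompact K) {f : X → F} (hf : ContinuousOn f K) :
    ∃ C : ℕ, ∀ x ∈ K, f x ∈ ballF (F := F) (-C) := by
  obtain ⟨C, hC⟩ := (hK.image_of_continuousOn hf).elim_directed_cover
    (fun C : ℕ => (ballF (F := F) (-C) : Set F)) (fun _ => isOpen_ballF _)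
    (fun a _ => Set.mem_iUnion.2 ⟨(-ordF F a).toNat, mem_ballF.2 (.inr (by omega))⟩)
    (directed_of_isDirected_le fun _ _ h => ballF_antitone (by omega))
  exact ⟨C, fun x hx => hC ⟨x, hx, rfl⟩⟩

lemma exists_forall_ordF_le_of_isCompact {X : Type*} [TopologicalSpace X] {K : Set X}
    (hK : IsCompact K) {f : X → F} (hf : ContinuousOn f K) (h0 : ∀ x ∈ K, f x ≠ 0) :
    ∃ C : ℕ, ∀ x ∈ K, ordF F (f x) ≤ C := by
  obtain ⟨C, hC⟩ := exists_forall_mem_ballF_of_isCompact hK (hf.inv₀ h0)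
  refine ⟨C, fun x hx => ?_⟩
  have hinv := (mem_ballF.1 (hC x hx)).resolve_left (inv_ne_zero (h0 x hx))
  rw [Pi.inv_apply, ordF_inv] at hinv
  exact neg_le_neg_iff.1 hinv

lemma exists_forall_mem_ballF_ordF {ι : Type*} [Finite ι] {c : ι → F} (hc : c ≠ 0) :
    ∃ i, c i ≠ 0 ∧ ∀ j, c j ∈ ballF (ordF F (c i)) := by
  obtain ⟨k, hk⟩ := Function.ne_iff.1 hc
  have := Nonempty.intro k
  obtain ⟨i, hi⟩ := Finite.exists_max fun j => valF F (c j)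
  have hne : c i ≠ 0 := (Valuation.ne_zero_iff (valF F)).1
    ((((Valuation.ne_zero_iff _).2 hk).bot_lt.trans_le (hi k)).ne')
  exact ⟨i, hne, fun j => (hi j).trans_eq (valF_eq_exp hne)⟩

end LocalField

open Module

section DivisionAlgebra

variable {F : Type*} [Field F]
variable {D : Type*} [DivisionRing D] [Algebra F D]

lemma algebraNorm_ne_zero {a : D} (ha : a ≠ 0) : Algebra.norm F a ≠ 0 := fun h => by
  simpa [h, ha] using map_mul (Algebra.norm F) a a⁻¹

lemma algebraNorm_smul [FiniteDimensional F D] (t : F) (a : D) :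
    Algebra.norm F (t • a) = t ^ finrank F D * Algebra.norm F a := by
  rw [Algebra.smul_def, map_mul, Algebra.norm_algebraMap]

variable [ValuativeRel F] [TopologicalSpace F] [IsNonarchimedeanLocalField F]

section Basis

variable {ι : Type*}

lemma isCompact_pi_ballF_zero : IsCompact {c : ι → F | ∀ i, c i ∈ ballF 0} := by
  convert isCompact_univ_pi fun _ : ι => isCompact_ballF_zero (F := F)
  ext c
  simp

lemma repr_smul_mem_ballF (b : Basis ι F D) {t : F} {a : D} {k : ℤ}
    (ha : ∀ i, b.repr a i ∈ ballF k) (i : ι) : b.repr (t • a) i ∈ ballF (ordF F t + k) := by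
  rw [map_smul, Finsupp.smul_apply, smul_eq_mul]
  exact mul_mem_ballF (mem_ballF.2 (.inr le_rfl)) (ha i)

lemma continuous_norm_sum_smul [Fintype ι] (b : Basis ι F D) :
    Continuous fun c : ι → F => Algebra.norm F (∑ i, c i • b i) := by
  classical
  simp_rw [Algebra.norm_eq_matrix_det b, map_sum, map_smul]
  exact Continuous.matrix_det (by fun_prop)

lemma exists_forall_ordF_norm_le [Fintype ι] (b : Basis ι F D) :
    ∃ C : ℕ, ∀ c : ι → F, (∀ i, c i ∈ ballF 0) → (∃ i, c i ∉ ballF 1) →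
      ordF F (Algebra.norm F (∑ i, c i • b i)) ≤ C := by
  have hclosed : IsClosed {c : ι → F | ∃ i, c i ∉ ballF (F := F) 1} := by
    rw [Set.ofPred_exists]
    exact isClosed_iUnion_of_finite fun i =>
      (isOpen_ballF 1).isClosed_compl.preimage (continuous_apply i)
  have hne : ∀ c : ι → F, (∃ i, c i ∉ ballF (F := F) 1) →
      Algebra.norm F (∑ i, c i • b i) ≠ 0 := fun c ⟨i, hi⟩ => algebraNorm_ne_zero fun h0 =>
    hi (by simp [Fintype.linearIndependent_iff.1 b.linearIndependent c h0 i])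
  obtain ⟨C, hC⟩ := exists_forall_ordF_le_of_isCompact (isCompact_pi_ballF_zero.inter_right hclosed)
    (continuous_norm_sum_smul b).continuousOn fun c hc => hne c hc.2
  exact ⟨C, fun c h0 h1 => hC c ⟨h0, h1⟩⟩

variable [FiniteDimensional F D]

lemma ordF_norm_smul {t : F} (ht : t ≠ 0) {a : D} (ha : a ≠ 0) :
    ordF F (Algebra.norm F (t • a)) =
      finrank F D * ordF F t + ordF F (Algebra.norm F a) := by
  rw [algebraNorm_smul, ordF_mul (pow_ne_zero _ ht) (algebraNorm_ne_zero ha), ordF_pow]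

lemma exists_forall_norm_mem_ballF [Finite ι] (b : Basis ι F D) : ∃ C : ℕ, ∀ (k : ℤ) (a : D),
    (∀ i, b.repr a i ∈ ballF k) → Algebra.norm F a ∈ ballF (finrank F D * k - C) := by
  have := Fintype.ofFinite ι
  obtain ⟨C, hC⟩ := exists_forall_mem_ballF_of_isCompact isCompact_pi_ballF_zero
    (continuous_norm_sum_smul b).continuousOn
  refine ⟨C, fun k a hk => ?_⟩
  obtain ⟨t, ht, htk⟩ := exists_ordF_eq F (-k)
  have hnorm := hC (b.repr (t • a)) fun i => by
    simpa only [htk, neg_add_cancel] using repr_smul_mem_ballF b (t := t) hk i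
  rw [b.sum_repr] at hnorm
  by_cases ha : a = 0
  · simp [ha]
  rw [mem_ballF, ordF_norm_smul ht ha, htk] at hnorm
  refine mem_ballF.2 (.inr ?_)
  linarith [hnorm.resolve_left (algebraNorm_ne_zero (smul_ne_zero ht ha))]

/-- Rescaling a largest coordinate of `a` to `1` moves `a` to the unit sphere, where the norm is
bounded below by compactness. -/
lemma exists_forall_repr_mem_ballF_of_norm_mem [Finite ι] (b : Basis ι F D) :
    ∃ C : ℕ, ∀ (k : ℤ) (a : D), Algebra.norm F a ∈ ballF (finrank F D * k) →
      ∀ i, b.repr a i ∈ ballF (k - C) := by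
  have := Fintype.ofFinite ι
  obtain ⟨C, hC⟩ := exists_forall_ordF_norm_le b
  refine ⟨C, fun k a hk i => ?_⟩
  by_cases ha : a = 0
  · simp [ha]
  obtain ⟨i₀, hne, hmax⟩ := exists_forall_mem_ballF_ordF (c := b.repr a)
    (fun h => ha (b.repr.map_eq_zero_iff.1 (DFunLike.coe_injective h)))
  set t := (b.repr a i₀)⁻¹
  have hone : b.repr (t • a) i₀ = 1 := by simp [t, hne]
  have hsphere := hC (b.repr (t • a))
    (fun j => by simpa only [t, ordF_inv, neg_add_cancel] using
      repr_smul_mem_ballF b (t := t) hmax j)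
    ⟨i₀, by rw [hone, mem_ballF]; simp⟩
  rw [b.sum_repr, ordF_norm_smul (inv_ne_zero hne) ha, ordF_inv] at hsphere
  have hn : 0 < (finrank F D : ℤ) := mod_cast finrank_pos
  have hle := (mem_ballF.1 hk).resolve_left (algebraNorm_ne_zero ha)
  refine ballF_antitone ?_ (hmax i)
  have hC0 : (0 : ℤ) ≤ C := C.cast_nonneg
  exact le_of_mul_le_mul_left (by nlinarith [hC0]) hn

end Basis

variable [FiniteDimensional F D]

/-- The powers `(1 + a) ^ k = ∑ (k choose j) a ^ j` stay in a bounded set, so that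
`k * ord (N (1 + a))` is bounded below independently of `k`. -/
lemma norm_one_add_mem_ballF {a : D} (ha : Algebra.norm F a ∈ ballF 0) :
    Algebra.norm F (1 + a) ∈ ballF 0 := by
  obtain ⟨C₁, hC₁⟩ := exists_forall_norm_mem_ballF (finBasis F D)
  obtain ⟨C₂, hC₂⟩ := exists_forall_repr_mem_ballF_of_norm_mem (finBasis F D)
  have hpow (j : ℕ) : Algebra.norm F (a ^ j) ∈ ballF (finrank F D * 0) := by
    rw [map_pow, mul_zero, mem_ballF_zero]
    exact pow_mem (mem_ballF_zero.1 ha) j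
  have hbound (k : ℕ) : Algebra.norm F ((1 + a) ^ k) ∈ ballF (finrank F D * -C₂ - C₁) := by
    refine hC₁ _ _ fun i => ?_
    rw [add_comm, (Commute.one_right a).add_pow, map_sum, Finsupp.finsetSum_apply]
    refine AddSubgroup.sum_mem _ fun j _ => ?_
    rw [one_pow, mul_one, ← (Nat.cast_commute _ _).eq, ← nsmul_eq_mul, map_nsmul]
    simpa using nsmul_mem (hC₂ 0 _ (hpow j) i) (k.choose j)
  by_contra hneg
  rw [mem_ballF, not_or, not_le] at hneg
  set M : ℕ := finrank F D * C₂ + C₁ + 1 with hM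
  have hlt := (mem_ballF.1 (hbound M)).resolve_left (by rw [map_pow]; exact pow_ne_zero _ hneg.1)
  rw [map_pow, ordF_pow] at hlt
  have hMpos : 0 ≤ (M : ℤ) := M.cast_nonneg
  have hMcast : (M : ℤ) = finrank F D * C₂ + C₁ + 1 := by rw [hM]; push_cast; ring
  nlinarith [hMpos, hMcast]

end DivisionAlgebra

section Valuation

variable {F : Type*} [Field F] [ValuativeRel F] [TopologicalSpace F]
  [IsNonarchimedeanLocalField F]
variable {D : Type*} [DivisionRing D] [Algebra F D]

lemma valD_mul {a b : D} (ha : a ≠ 0) (hb : b ≠ 0) : valD F (a * b) = valD F a + valD F b := by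
  rw [valD, map_mul, ordF_mul (algebraNorm_ne_zero ha) (algebraNorm_ne_zero hb), Int.cast_add,
    add_div, valD, valD]

@[simp] lemma valD_one : valD F (1 : D) = 0 := by simp [valD]

lemma valD_inv {a : D} (ha : a ≠ 0) : valD F a⁻¹ = -valD F a := by
  rw [eq_neg_iff_add_eq_zero, add_comm, ← valD_mul ha (inv_ne_zero ha), mul_inv_cancel₀ ha,
    valD_one]

lemma valD_pow (a : D) (k : ℕ) : valD F (a ^ k) = k * valD F a := by
  rw [valD, map_pow, ordF_pow, Int.cast_mul, Int.cast_natCast, mul_div_assoc, valD]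

lemma valD_zpow {a : D} (ha : a ≠ 0) (k : ℤ) : valD F (a ^ k) = k * valD F a := by
  cases k with
  | ofNat k => simpa using valD_pow a k
  | negSucc k => rw [zpow_negSucc, valD_inv (pow_ne_zero _ ha), valD_pow]; push_cast; ring

lemma valD_neg (a : D) : valD F (-a) = valD F a := by
  by_cases ha : a = 0
  · simp [ha]
  have hsq := valD_pow (F := F) (-1 : D) 2
  rw [neg_one_sq, valD_one, Nat.cast_ofNat, zero_eq_mul] at hsq
  rw [neg_eq_neg_one_mul, valD_mul (neg_ne_zero.2 one_ne_zero) ha,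
    hsq.resolve_left two_ne_zero, zero_add]

lemma mul_mem_ballD {a b : D} {s t : ℝ} (ha : a ∈ ballD F s) (hb : b ∈ ballD F t) :
    a * b ∈ ballD F (s + t) := by
  by_cases ha0 : a = 0
  · exact .inl (by simp [ha0])
  by_cases hb0 : b = 0
  · exact .inl (by simp [hb0])
  exact .inr ((add_le_add (ha.resolve_left ha0) (hb.resolve_left hb0)).trans_eq
    (valD_mul ha0 hb0).symm)

variable [FiniteDimensional F D]

lemma mem_ballD_intCast {a : D} {k : ℤ} :
    a ∈ ballD F (k : ℝ) ↔ Algebra.norm F a ∈ ballF (finrank F D * k) := by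
  have hn : (0 : ℝ) < finrank F D := mod_cast finrank_pos
  by_cases ha : a = 0
  · simp [ballD, ha]
  change a = 0 ∨ _ ↔ _
  rw [mem_ballF, or_iff_right ha, or_iff_right (algebraNorm_ne_zero ha), valD,
    le_div_iff₀ hn, mul_comm]
  exact_mod_cast Iff.rfl

lemma one_add_mem_ballD_zero {a : D} (ha : a ∈ ballD F 0) : 1 + a ∈ ballD F 0 := by
  rw [← Int.cast_zero, mem_ballD_intCast, mul_zero] at *
  exact norm_one_add_mem_ballF ha

lemma add_mem_ballD {a b : D} {s : ℝ} (ha : a ∈ ballD F s) (hb : b ∈ ballD F s) :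
    a + b ∈ ballD F s := by
  by_cases ha0 : a = 0
  · rwa [ha0, zero_add]
  by_cases hb0 : b = 0
  · rwa [hb0, add_zero]
  wlog h : valD F a ≤ valD F b generalizing a b
  · exact add_comm a b ▸ this hb ha hb0 ha0 (le_of_not_ge h)
  have hquot : a⁻¹ * b ∈ ballD F 0 := .inr (by
    rw [valD_mul (inv_ne_zero ha0) hb0, valD_inv ha0]; linarith)
  simpa [mul_add, ha0] using mul_mem_ballD ha (one_add_mem_ballD_zero hquot)

variable (F) in
/-- The fractional ideal `ballD F s` as an additive subgroup of `D`. -/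
def ball (s : ℝ) : AddSubgroup D where
  carrier := ballD F s
  zero_mem' := .inl rfl
  neg_mem' {a} := Or.imp neg_eq_zero.2 fun h => by rwa [valD_neg]
  add_mem' := add_mem_ballD

lemma mem_ball {a : D} {s : ℝ} : a ∈ ball F s ↔ a = 0 ∨ s ≤ valD F a := Iff.rfl

lemma mem_ball_of_ne_zero {a : D} (ha : a ≠ 0) {s : ℝ} : a ∈ ball F s ↔ s ≤ valD F a :=
  or_iff_right ha

lemma ball_antitone : Antitone (ball F (D := D)) := fun _ _ h _ ha => ha.imp_right h.trans

lemma mul_mem_ball {a b : D} {s t : ℝ} (ha : a ∈ ball F s) (hb : b ∈ ball F t) :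
    a * b ∈ ball F (s + t) := mul_mem_ballD ha hb

lemma one_mem_ball : (1 : D) ∈ ball F 0 := .inr valD_one.ge

lemma valD_algebraMap (a : F) : valD F (algebraMap F D a) = ordF F a := by
  rw [valD, Algebra.norm_algebraMap, ordF_pow, Int.cast_mul, Int.cast_natCast,
    mul_div_cancel_left₀ _ (mod_cast finrank_pos.ne')]

lemma smul_mem_ball {t : F} {k : ℤ} (ht : t ∈ ballF k) {a : D} {s : ℝ} (ha : a ∈ ball F s) :
    t • a ∈ ball F (k + s) := by
  rw [Algebra.smul_def]
  refine mul_mem_ball ?_ ha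
  rcases mem_ballF.1 ht with rfl | h
  · simp
  · exact .inr (by rw [valD_algebraMap]; exact_mod_cast h)

variable (F) in
lemma exists_forall_repr_mem_ballF {ι : Type*} [Finite ι] (b : Basis ι F D) :
    ∃ C : ℕ, ∀ (k : ℤ) (a : D), a ∈ ball F k → ∀ i, b.repr a i ∈ ballF (k - C) := by
  obtain ⟨C, hC⟩ := exists_forall_repr_mem_ballF_of_norm_mem b
  exact ⟨C, fun k a ha => hC k a (mem_ballD_intCast.1 ha)⟩

lemma exists_natCast_dvd_iff_mem (S : AddSubgroup ℤ) :
    ∃ g : ℕ, ∀ k : ℤ, k ∈ S ↔ (g : ℤ) ∣ k := by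
  obtain ⟨z, hz⟩ := Int.subgroup_cyclic S
  refine ⟨z.natAbs, fun k => ?_⟩
  rw [hz, AddSubgroup.mem_closure_singleton, Int.natAbs_dvd]
  simp only [dvd_def, smul_eq_mul, mul_comm, eq_comm]

variable (F D) in
lemma exists_dvd_ordF_norm :
    ∃ g : ℕ, g ∣ finrank F D ∧ (∀ a : D, a ≠ 0 → (g : ℤ) ∣ ordF F (Algebra.norm F a)) ∧
      ∃ a : D, a ≠ 0 ∧ ordF F (Algebra.norm F a) = g := by
  let S : AddSubgroup ℤ :=
    { carrier := {k | ∃ a : D, a ≠ 0 ∧ ordF F (Algebra.norm F a) = k}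
      zero_mem' := ⟨1, one_ne_zero, by simp⟩
      add_mem' := by
        rintro _ _ ⟨a, ha, rfl⟩ ⟨b, hb, rfl⟩
        exact ⟨a * b, mul_ne_zero ha hb, by
          rw [map_mul, ordF_mul (algebraNorm_ne_zero ha) (algebraNorm_ne_zero hb)]⟩
      neg_mem' := by
        rintro _ ⟨a, ha, rfl⟩
        exact ⟨a⁻¹, inv_ne_zero ha, by
          rw [eq_neg_iff_add_eq_zero, ← ordF_mul (algebraNorm_ne_zero (inv_ne_zero ha))
            (algebraNorm_ne_zero ha), ← map_mul, inv_mul_cancel₀ ha, map_one, ordF_one]⟩ }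
  obtain ⟨g, hg⟩ := exists_natCast_dvd_iff_mem S
  obtain ⟨t, ht, hord⟩ := exists_ordF_eq F 1
  have hfinrank : (finrank F D : ℤ) ∈ S :=
    ⟨algebraMap F D t, by simpa using ht, by rw [Algebra.norm_algebraMap, ordF_pow, hord, mul_one]⟩
  exact ⟨g, Int.natCast_dvd_natCast.1 ((hg _).1 hfinrank), fun a ha => (hg _).1 ⟨a, ha, rfl⟩,
    (hg g).2 dvd_rfl⟩

variable (F) in
/-- `ϖ` is a prime element of `D`, and `d` is the ramification index of `D` over `F`, so that
`v(Dˣ) = (1 / d)ℤ` is generated by `v(ϖ) = 1 / d`. -/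
structure IsUniformizer (d : ℕ) (ϖ : D) : Prop where
  pos : 0 < d
  ne_zero : ϖ ≠ 0
  valD_eq : valD F ϖ = 1 / d
  exists_valD_eq (a : D) (ha : a ≠ 0) : ∃ k : ℤ, valD F a = k / d

variable (F D) in
lemma exists_isUniformizer : ∃ (d : ℕ) (ϖ : D), IsUniformizer F d ϖ := by
  obtain ⟨g, ⟨d, hd⟩, hdvd, ϖ, hϖ, hϖg⟩ := exists_dvd_ordF_norm F D
  have hgd : g * d ≠ 0 := hd ▸ finrank_pos.ne'
  have hg : (g : ℝ) ≠ 0 := mod_cast left_ne_zero_of_mul hgd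
  have hd0 : (d : ℝ) ≠ 0 := mod_cast right_ne_zero_of_mul hgd
  refine ⟨d, ϖ, Nat.pos_of_ne_zero (right_ne_zero_of_mul hgd), hϖ, ?_, fun a ha => ?_⟩
  · rw [valD, hϖg, hd]
    push_cast
    field_simp
  · obtain ⟨k, hk⟩ := hdvd a ha
    refine ⟨k, ?_⟩
    rw [valD, hk, hd]
    push_cast
    field_simp

end Valuation

section MoyPrasadGroups

variable {F : Type*} [Field F] [ValuativeRel F] [TopologicalSpace F]
  [IsNonarchimedeanLocalField F]
variable {D : Type*} [DivisionRing D] [Algebra F D] {m : ℕ} {x : Fin m → ℝ}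

/-- The element `1 + c E_{ij}`, `i ≠ j`, of a root subgroup of `GL_m(D)`. -/
def rootElement {i j : Fin m} (hij : i ≠ j) (c : D) : GLD D m where
  val := 1 + Matrix.single i j c
  inv := 1 + Matrix.single i j (-c)
  val_inv := by simp [add_mul, mul_add, hij.symm, add_assoc, ← Matrix.single_add]
  inv_val := by simp [add_mul, mul_add, hij.symm, add_assoc, ← Matrix.single_add]

lemma rootElement_mem_moyPrasadStd {i j : Fin m} (hij : i ≠ j) {c : D} {s : ℝ}
    (hc : c ∈ ballD F (s - (x i - x j))) : rootElement hij c ∈ moyPrasadStd F D x s :=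
  Subgroup.subset_closure (.inr (by simpa only [Set.mem_iUnion] using ⟨i, j, hij, c, hc, rfl⟩))

variable [FiniteDimensional F D]

variable (F) in
/-- The Moy-Prasad lattice `{b | v(b i j) + x i - x j ≥ s}` in `M_m(D)`. -/
def matBall (x : Fin m → ℝ) (s : ℝ) : AddSubgroup (Matrix (Fin m) (Fin m) D) where
  carrier := {b | ∀ i j, b i j ∈ ball F (s - (x i - x j))}
  zero_mem' _ _ := AddSubgroup.zero_mem _
  add_mem' ha hb i j := AddSubgroup.add_mem _ (ha i j) (hb i j)
  neg_mem' ha i j := AddSubgroup.neg_mem _ (ha i j)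

lemma matBall_antitone : Antitone (matBall F (D := D) x) := fun _ _ h _ hb i j =>
  ball_antitone (by linarith) (hb i j)

lemma mul_mem_matBall {s t : ℝ} {a b : Matrix (Fin m) (Fin m) D} (ha : a ∈ matBall F x s)
    (hb : b ∈ matBall F x t) : a * b ∈ matBall F x (s + t) := fun i j => by
  rw [Matrix.mul_apply]
  refine AddSubgroup.sum_mem _ fun k _ => ?_
  convert mul_mem_ball (ha i k) (hb k j) using 2
  ring

lemma single_mem_matBall {s : ℝ} {i j : Fin m} {c : D} (hc : c ∈ ball F (s - (x i - x j))) :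
    Matrix.single i j c ∈ matBall F x s := fun i' j' => by
  rw [Matrix.single_apply]
  split_ifs with h
  · rwa [← h.1, ← h.2]
  · exact AddSubgroup.zero_mem _

lemma diagonal_mem_matBall {s : ℝ} {t : Fin m → D} (ht : ∀ i, t i ∈ ball F s) :
    Matrix.diagonal t ∈ matBall F x s := fun i j => by
  rw [Matrix.diagonal_apply]
  split_ifs with h
  · rw [h, sub_self, sub_zero]
    exact ht j
  · exact AddSubgroup.zero_mem _

lemma one_mem_matBall : (1 : Matrix (Fin m) (Fin m) D) ∈ matBall F x 0 :=
  Matrix.diagonal_one (n := Fin m) (α := D) ▸ diagonal_mem_matBall fun _ => one_mem_ball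

lemma mul_sub_one_mem_matBall {s : ℝ} (hs : 0 ≤ s) {a b : Matrix (Fin m) (Fin m) D}
    (ha : a - 1 ∈ matBall F x s) (hb : b - 1 ∈ matBall F x s) : a * b - 1 ∈ matBall F x s := by
  have hab : a * b - 1 = (a - 1) * (b - 1) + (a - 1) + (b - 1) := by noncomm_ring
  rw [hab]
  exact AddSubgroup.add_mem _ (AddSubgroup.add_mem _
    (matBall_antitone (by linarith) (mul_mem_matBall ha hb)) ha) hb

/-- The group `(1 + matBall F x s) ∩ (1 + matBall F x s)⁻¹`, which turns out to be the Moy-Prasad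
group `P_{x,s}` when `s > 0`. -/
def congruenceSubgroup (x : Fin m → ℝ) {s : ℝ} (hs : 0 ≤ s) : Subgroup (GLD D m) where
  carrier := {g | (g : Matrix (Fin m) (Fin m) D) - 1 ∈ matBall F x s ∧
    ((g⁻¹ : GLD D m) : Matrix (Fin m) (Fin m) D) - 1 ∈ matBall F x s}
  one_mem' := by simp
  mul_mem' hg hh := by
    rw [Set.mem_ofPred_eq, mul_inv_rev]
    exact ⟨mul_sub_one_mem_matBall hs hg.1 hh.1, mul_sub_one_mem_matBall hs hh.2 hg.2⟩
  inv_mem' {g} hg := ⟨hg.2, by simpa only [inv_inv] using hg.1⟩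

lemma inv_sub_one_mem_ball {t : D} {s : ℝ} (ht : t ≠ 0) (hv : valD F t = 0)
    (h : t - 1 ∈ ball F s) : t⁻¹ - 1 ∈ ball F s := by
  have hsub : t⁻¹ - 1 = -((t - 1) * t⁻¹) := by
    rw [sub_mul, mul_inv_cancel₀ ht, one_mul, neg_sub]
  have hinv : t⁻¹ ∈ ball F 0 := .inr (by rw [valD_inv ht, hv, neg_zero])
  rw [hsub]
  exact AddSubgroup.neg_mem _ (by simpa only [add_zero] using mul_mem_ball h hinv)

lemma leviFiltration_subset_congruenceSubgroup {s : ℝ} (hs : 0 ≤ s) :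
    leviFiltration F D s ⊆ (congruenceSubgroup (F := F) (D := D) x hs : Set (GLD D m)) := by
  rintro g ⟨t, hgt, ht⟩
  have hinv : ((g⁻¹ : GLD D m) : Matrix (Fin m) (Fin m) D) = Matrix.diagonal fun i => (t i)⁻¹ :=
    Units.inv_eq_of_mul_eq_one_right (by simp [hgt, fun i => mul_inv_cancel₀ (ht i).1])
  constructor
  · rw [hgt, ← Matrix.diagonal_one, Matrix.diagonal_sub]
    exact diagonal_mem_matBall fun i => (ht i).2.2
  · rw [hinv, ← Matrix.diagonal_one, Matrix.diagonal_sub]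
    exact diagonal_mem_matBall fun i => inv_sub_one_mem_ball (ht i).1 (ht i).2.1 (ht i).2.2

lemma rootFiltration_subset_congruenceSubgroup {s : ℝ} (hs : 0 ≤ s) {i j : Fin m} (hij : i ≠ j) :
    rootFiltration F D i j (s - (x i - x j)) ⊆
      (congruenceSubgroup (F := F) (D := D) x hs : Set (GLD D m)) := by
  rintro g ⟨c, hc, hgc⟩
  obtain rfl : g = rootElement hij c := Units.ext hgc
  constructor
  · simpa [rootElement] using single_mem_matBall hc
  · simpa [rootElement] using single_mem_matBall (AddSubgroup.neg_mem (ball F _) hc)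

lemma moyPrasadStd_le_congruenceSubgroup {s : ℝ} (hs : 0 ≤ s) :
    moyPrasadStd F D x s ≤ congruenceSubgroup (F := F) x hs :=
  (Subgroup.closure_le _).2 <| Set.union_subset (leviFiltration_subset_congruenceSubgroup hs) <|
    Set.iUnion_subset fun _ => Set.iUnion_subset fun _ => Set.iUnion_subset fun hij =>
      rootFiltration_subset_congruenceSubgroup hs hij

lemma one_add_ne_zero_and_valD_eq_zero {c : D} {s : ℝ} (hs : 0 < s) (hc : c ∈ ball F s) :
    1 + c ≠ 0 ∧ valD F (1 + c) = 0 := by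
  have hone {r : ℝ} (hr : 0 < r) : (1 : D) ∉ ball F r := by
    rwa [mem_ball_of_ne_zero one_ne_zero, valD_one, not_le]
  have h0 : 1 + c ≠ 0 := fun h => hone hs <| by
    rw [eq_neg_of_add_eq_zero_left h]
    exact AddSubgroup.neg_mem _ hc
  refine ⟨h0, le_antisymm (not_lt.1 fun hlt => hone (lt_min hs hlt) ?_) ?_⟩
  · simpa using AddSubgroup.sub_mem _
      (ball_antitone (min_le_right s _) ((mem_ball_of_ne_zero h0).2 le_rfl))
      (ball_antitone (min_le_left s (valD F (1 + c))) hc)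
  · exact (mem_ball_of_ne_zero h0).1 (AddSubgroup.add_mem _ one_mem_ball (ball_antitone hs.le hc))

lemma exists_mem_moyPrasadStd_eq_diagonal {s : ℝ} (hs : 0 < s) {t : Fin m → D}
    (ht : ∀ i, t i - 1 ∈ ball F s) :
    ∃ q ∈ moyPrasadStd F D x s, (q : Matrix (Fin m) (Fin m) D) = Matrix.diagonal t := by
  have hunit (i : Fin m) : t i ≠ 0 ∧ valD F (t i) = 0 := by
    simpa using one_add_ne_zero_and_valD_eq_zero hs (ht i)
  let q : GLD D m := ⟨Matrix.diagonal t, Matrix.diagonal fun i => (t i)⁻¹,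
    by simp [fun i => mul_inv_cancel₀ (hunit i).1], by simp [fun i => inv_mul_cancel₀ (hunit i).1]⟩
  exact ⟨q, Subgroup.subset_closure (.inl ⟨t, rfl, fun i => ⟨(hunit i).1, (hunit i).2, ht i⟩⟩), rfl⟩

lemma exists_mem_moyPrasadStd_eq_one_add_sum {s : ℝ} {k : Fin m} {f : Fin m → D}
    (hf : ∀ i, f i ∈ ball F (s - (x i - x k))) {T : Finset (Fin m)} (hT : k ∉ T) :
    ∃ p ∈ moyPrasadStd F D x s,
      (p : Matrix (Fin m) (Fin m) D) = 1 + ∑ i ∈ T, Matrix.single i k (f i) := by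
  induction T using Finset.induction_on with
  | empty => exact ⟨1, one_mem _, by simp⟩
  | insert i T hi ih =>
    rw [Finset.mem_insert, not_or] at hT
    obtain ⟨p, hp, hpe⟩ := ih hT.2
    refine ⟨_, mul_mem (rootElement_mem_moyPrasadStd (Ne.symm hT.1) (hf i)) hp, ?_⟩
    have hvanish : ∑ j ∈ T, Matrix.single i k (f i) * Matrix.single j k (f j) = 0 :=
      Finset.sum_eq_zero fun j hj => Matrix.single_mul_single_of_ne _ _ _ _
        (ne_of_mem_of_not_mem hj hT.2).symm _
    rw [Units.val_mul, hpe, Finset.sum_insert hi, rootElement, add_mul, one_mul, mul_add, mul_one,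
      Finset.mul_sum, hvanish]
    abel

/-- Elimination in the `k`-th column. With `u = 1 + a k k`, a unit of the maximal order, the matrix
`1 + a E_{kk}` is the product of `1 + ∑_{i ≠ k} a i k u⁻¹ E_{ik}` and `diag(1, …, u, …, 1)`. -/
lemma exists_mem_moyPrasadStd_eq_one_add_mul_single {s : ℝ} (hs : 0 < s)
    {a : Matrix (Fin m) (Fin m) D} (ha : a ∈ matBall F x s) (k : Fin m) :
    ∃ p ∈ moyPrasadStd F D x s,
      (p : Matrix (Fin m) (Fin m) D) = 1 + a * Matrix.single k k 1 := by
  have hkk : a k k ∈ ball F s := by simpa using ha k k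
  obtain ⟨hu, hv⟩ := one_add_ne_zero_and_valD_eq_zero hs hkk
  set u := 1 + a k k with hu_def
  have huinv : u⁻¹ ∈ ball F 0 := .inr (by rw [valD_inv hu, hv, neg_zero])
  obtain ⟨p, hp, hpe⟩ := exists_mem_moyPrasadStd_eq_one_add_sum (F := F) (x := x) (s := s)
    (f := fun i => a i k * u⁻¹) (fun i => by simpa using mul_mem_ball (ha i k) huinv)
    (Finset.notMem_erase k Finset.univ)
  obtain ⟨q, hq, hqe⟩ := exists_mem_moyPrasadStd_eq_diagonal (F := F) (x := x) hs
    (t := Function.update 1 k u) fun i => by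
      by_cases h : i = k
      · subst h
        simpa [hu_def] using hkk
      · simp [h]
  refine ⟨p * q, mul_mem hp hq, ?_⟩
  rw [Units.val_mul, hpe, hqe]
  ext i j
  rw [Matrix.mul_diagonal, Matrix.add_apply, Matrix.add_apply, Matrix.sum_apply]
  by_cases hj : j = k
  · subst hj
    rw [Matrix.mul_single_apply_same, mul_one, Function.update_self]
    by_cases hi : i = j
    · subst hi
      rw [Finset.sum_eq_zero fun l hl =>
        Matrix.single_apply_of_row_ne (Finset.ne_of_mem_erase hl) ..]
      simp [hu_def]
    · rw [Finset.sum_eq_single i (fun l _ hl => Matrix.single_apply_of_row_ne hl ..)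
        (by simp [hi])]
      simp [Matrix.one_apply_ne hi, hu]
  · rw [Matrix.mul_single_apply_of_ne _ _ _ _ _ hj, Finset.sum_eq_zero
      fun l _ => Matrix.single_apply_of_col_ne _ _ (Ne.symm hj) _]
    simp [hj]

lemma mul_single_one_mem_matBall {s : ℝ} {a : Matrix (Fin m) (Fin m) D} (ha : a ∈ matBall F x s)
    (k : Fin m) : a * Matrix.single k k 1 ∈ matBall F x s := by
  simpa only [add_zero] using
    mul_mem_matBall ha (single_mem_matBall (s := 0) (by simpa using one_mem_ball))

/-- Gaussian elimination: clear the columns with index in `T` one after the other. -/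
lemma exists_mem_moyPrasadStd_eq_one_add_of_forall_notMem {s : ℝ} (hs : 0 < s)
    (T : Finset (Fin m)) {a : Matrix (Fin m) (Fin m) D} (ha : a ∈ matBall F x s)
    (hT : ∀ j ∉ T, ∀ i, a i j = 0) :
    ∃ g ∈ moyPrasadStd F D x s, (g : Matrix (Fin m) (Fin m) D) = 1 + a := by
  induction T using Finset.induction_on generalizing a with
  | empty =>
    obtain rfl : a = 0 := Matrix.ext fun i j => hT j (Finset.notMem_empty j) i
    exact ⟨1, one_mem _, by simp⟩
  | insert k T hk ih =>
    obtain ⟨p, hp, hpe⟩ := exists_mem_moyPrasadStd_eq_one_add_mul_single hs ha k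
    set r : Matrix (Fin m) (Fin m) D := a - a * Matrix.single k k 1 with hr
    have hcol (j : Fin m) (hj : j ∉ T) (i : Fin m) : r i j = 0 := by
      rw [hr, Matrix.sub_apply]
      by_cases hjk : j = k
      · subst hjk
        simp
      · rw [Matrix.mul_single_apply_of_ne _ _ _ _ _ hjk, sub_zero]
        exact hT j (by simp [hj, hjk]) i
    have hpinv : ((p⁻¹ : GLD D m) : Matrix (Fin m) (Fin m) D) ∈ matBall F x 0 := by
      simpa using AddSubgroup.add_mem _ (matBall_antitone hs.le
        (moyPrasadStd_le_congruenceSubgroup hs.le hp).2) one_mem_matBall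
    have hball : ((p⁻¹ : GLD D m) : Matrix (Fin m) (Fin m) D) * r ∈ matBall F x s := by
      simpa only [zero_add] using
        mul_mem_matBall hpinv (AddSubgroup.sub_mem _ ha (mul_single_one_mem_matBall ha k))
    obtain ⟨g, hg, hge⟩ := ih hball fun j hj i => by
      rw [Matrix.mul_apply]
      exact Finset.sum_eq_zero fun l _ => by rw [hcol j hj l, mul_zero]
    refine ⟨p * g, mul_mem hp hg, ?_⟩
    rw [Units.val_mul, hge, mul_add, Units.mul_inv_cancel_left, mul_one, hpe, hr]
    abel

lemma mem_moyPrasadStd_iff {s : ℝ} (hs : 0 < s) {g : GLD D m} :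
    g ∈ moyPrasadStd F D x s ↔ (g : Matrix (Fin m) (Fin m) D) - 1 ∈ matBall F x s := by
  refine ⟨fun hg => (moyPrasadStd_le_congruenceSubgroup hs.le hg).1, fun hg => ?_⟩
  obtain ⟨p, hp, hpe⟩ := exists_mem_moyPrasadStd_eq_one_add_of_forall_notMem hs Finset.univ hg
    (by simp)
  rw [add_sub_cancel, Units.val_inj] at hpe
  exact hpe ▸ hp

end MoyPrasadGroups

section RotationNumber

section RoundDown

variable {ι : Type*} [Fintype ι] [Nonempty ι]

/-- Rounding `t + R` down to an element of `⋃ i, X i + ℤ`. -/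
def roundDown (X : ι → ℝ) (R t : ℝ) : ℝ :=
  Finset.univ.sup' Finset.univ_nonempty fun i => X i + ⌊t + R - X i⌋

variable {X : ι → ℝ} {R : ℝ}

lemma roundDown_le (t : ℝ) : roundDown X R t ≤ t + R :=
  Finset.sup'_le _ _ fun i _ => by linarith [Int.floor_le (t + R - X i)]

lemma le_roundDown {t : ℝ} {i : ι} {k : ℤ} (h : X i + k ≤ t + R) :
    X i + k ≤ roundDown X R t := by
  refine le_trans ?_ (Finset.le_sup' (fun i => X i + (⌊t + R - X i⌋ : ℝ)) (Finset.mem_univ i))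
  gcongr
  exact Int.le_floor.2 (by linarith)

lemma exists_roundDown_eq (t : ℝ) : ∃ (i : ι) (k : ℤ), roundDown X R t = X i + k := by
  obtain ⟨i, -, h⟩ := Finset.exists_mem_eq_sup' Finset.univ_nonempty
    fun i => X i + (⌊t + R - X i⌋ : ℝ)
  exact ⟨i, _, h⟩

lemma roundDown_le_roundDown_add {t u : ℝ} {k : ℤ} (h : t ≤ u + k) :
    roundDown X R t ≤ roundDown X R u + k := by
  obtain ⟨i, l, hl⟩ := exists_roundDown_eq (X := X) (R := R) t
  have hle : X i + ((l - k : ℤ) : ℝ) ≤ roundDown X R u := le_roundDown (by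
    push_cast
    linarith [roundDown_le (X := X) (R := R) t])
  push_cast at hle
  linarith

lemma le_roundDown_self (hR : 0 ≤ R) {t : ℝ} (ht : ∃ (i : ι) (k : ℤ), t = X i + k) :
    t ≤ roundDown X R t := by
  obtain ⟨i, k, rfl⟩ := ht
  exact le_roundDown (by linarith)

end RoundDown

section CountBelow

/-- The number of points of `⋃ n < N, u n + ℤ` below `t`, normalized by counting in `u n + ℤ` only
from `u n` upwards if `u n < t`, and negatively from `t` upwards otherwise. -/
def countBelow (u : ℕ → ℝ) (N : ℕ) (t : ℝ) : ℤ := ∑ n ∈ Finset.range N, ⌈t - u n⌉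

variable {u : ℕ → ℝ} {N : ℕ}

lemma countBelow_mono : Monotone (countBelow u N) := fun _ _ h =>
  Finset.sum_le_sum fun _ _ => Int.ceil_mono (by linarith)

lemma countBelow_add_intCast (t : ℝ) (k : ℤ) :
    countBelow u N (t + k) = countBelow u N t + k * N := by
  have hceil (n : ℕ) : ⌈t + k - u n⌉ = ⌈t - u n⌉ + k := by
    rw [add_sub_right_comm, Int.ceil_add_intCast]
  simp [countBelow, hceil, Finset.sum_add_distrib, mul_comm]

lemma countBelow_lt_countBelow {c : ℕ} (hc : c < N) {l : ℤ} {t : ℝ} (ht : u c + l < t) :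
    countBelow u N (u c + l) < countBelow u N t := by
  refine Finset.sum_lt_sum (fun n _ => Int.ceil_mono (by linarith)) ⟨c, Finset.mem_range.2 hc, ?_⟩
  rw [add_sub_cancel_left, Int.ceil_intCast, Int.lt_ceil]
  linarith

lemma eq_add_of_countBelow_eq {a b : ℕ} (ha : a < N) (hb : b < N) {k : ℤ}
    (h : countBelow u N (u a) = countBelow u N (u b) + k * N) : u a = u b + k := by
  rw [← countBelow_add_intCast] at h
  refine le_antisymm (not_lt.1 fun hlt => ?_) (not_lt.1 fun hlt => ?_)
  · exact (countBelow_lt_countBelow hb hlt).ne h.symm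
  · have hcount := countBelow_lt_countBelow ha (l := 0) (by simpa using hlt)
    rw [Int.cast_zero, add_zero] at hcount
    exact hcount.ne h

lemma exists_countBelow_add_eq (hN : 0 < N)
    (hinj : ∀ a < N, ∀ b < N, ∀ k : ℤ, u a = u b + k → a = b) (c : ℤ) :
    ∃ a, ∃ k : ℤ, countBelow u N (u a) + k * N = c := by
  have : NeZero N := ⟨hN.ne'⟩
  have hinjective : Function.Injective fun a : Fin N => (countBelow u N (u a) : ZMod N) := by
    intro a b hab
    obtain ⟨k, hk⟩ := (ZMod.intCast_eq_intCast_iff_dvd_sub _ _ _).1 hab.symm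
    exact Fin.ext (hinj a a.2 b b.2 k (eq_add_of_countBelow_eq a.2 b.2 (by linarith)))
  obtain ⟨a, ha⟩ := ((Fintype.bijective_iff_injective_and_card _).2
    ⟨hinjective, by simp [ZMod.card]⟩).2 (c : ZMod N)
  obtain ⟨k, hk⟩ := (ZMod.intCast_eq_intCast_iff_dvd_sub _ _ _).1 ha
  exact ⟨a, k, by linarith⟩

end CountBelow

variable {ι : Type*} [Fintype ι] {X : ι → ℝ} {R : ℝ}

lemma exists_minimal_return {s : ℕ → ℝ} (hs : ∀ n, ∃ (i : ι) (k : ℤ), s n = X i + k) :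
    ∃ (N n₀ : ℕ) (P : ℤ), 0 < N ∧ N ≤ Fintype.card ι ∧ s (n₀ + N) = s n₀ + P ∧
      ∀ (M n : ℕ) (k : ℤ), 0 < M → s (n + M) = s n + k → N ≤ M := by
  classical
  choose i k hik using hs
  let returnsAfter (N : ℕ) : Prop := 0 < N ∧ ∃ (n : ℕ) (k : ℤ), s (n + N) = s n + k
  have hpigeonhole : ∃ N, returnsAfter N ∧ N ≤ Fintype.card ι := by
    obtain ⟨a, b, hab, h⟩ := Fintype.exists_ne_map_eq_of_card_lt
      (fun n : Fin (Fintype.card ι + 1) => i n) (by simp)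
    wlog hlt : (a : ℕ) < b generalizing a b
    · exact this b a hab.symm h.symm (by omega)
    refine ⟨b - a, ⟨by omega, a, k b - k a, ?_⟩, by omega⟩
    rw [Nat.add_sub_cancel' hlt.le, hik b, hik a, h]
    push_cast
    ring
  obtain ⟨N', hN', hcard⟩ := hpigeonhole
  have hex : ∃ N, returnsAfter N := ⟨N', hN'⟩
  obtain ⟨hpos, n₀, P, hP⟩ := Nat.find_spec hex
  exact ⟨Nat.find hex, n₀, P, hpos, (Nat.find_min' hex hN').trans hcard, hP,
    fun M n k hM h => Nat.find_min' hex ⟨hM, n, k, h⟩⟩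

variable [Nonempty ι]

variable (X R) in
lemma exists_roundDown_cycle (hR : 0 ≤ R) :
    ∃ (u : ℕ → ℝ) (N P : ℕ), 0 < N ∧ N ≤ Fintype.card ι ∧ (P : ℝ) ≤ N * R ∧
      (∀ n, ∃ (i : ι) (k : ℤ), u n = X i + k) ∧ (∀ n, u (n + 1) = roundDown X R (u n)) ∧
      u N = u 0 + P ∧ ∀ a < N, ∀ b < N, ∀ k : ℤ, u a = u b + k → a = b := by
  let s (n : ℕ) : ℝ := (roundDown X R)^[n] (X (Classical.arbitrary ι))
  have hsucc (n : ℕ) : s (n + 1) = roundDown X R (s n) := Function.iterate_succ_apply' _ _ _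
  have hs (n : ℕ) : ∃ (i : ι) (k : ℤ), s n = X i + k := by
    cases n with
    | zero => exact ⟨Classical.arbitrary ι, 0, by simp [s]⟩
    | succ n => exact hsucc n ▸ exists_roundDown_eq (s n)
  obtain ⟨N, n₀, P, hN, hcard, hP, hmin⟩ := exists_minimal_return hs
  have hmono : Monotone s := monotone_nat_of_le_succ fun n => hsucc n ▸ le_roundDown_self hR (hs n)
  have hle (n : ℕ) : s (n₀ + n) ≤ s n₀ + n * R := by
    induction n with
    | zero => simp
    | succ n ih =>
      have hstep : s (n₀ + (n + 1)) ≤ s (n₀ + n) + R := hsucc (n₀ + n) ▸ roundDown_le _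
      push_cast
      linarith
  have hP0 : 0 ≤ P := by
    have hP0' : (0 : ℝ) ≤ P := by linarith [hmono (Nat.le_add_right n₀ N)]
    exact_mod_cast hP0'
  lift P to ℕ using hP0
  rw [Int.cast_natCast] at hP
  refine ⟨fun n => s (n₀ + n), N, P, hN, hcard, by linarith [hle N], fun n => hs _,
    fun n => hsucc _, hP, fun a ha b hb k hab => ?_⟩
  refine le_antisymm (not_lt.1 fun hlt => ?_) (not_lt.1 fun hlt => ?_)
  · have hNle := hmin (a - b) (n₀ + b) k (by omega)
      (by rwa [add_assoc, Nat.add_sub_cancel' hlt.le])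
    omega
  · have hNle := hmin (b - a) (n₀ + a) (-k) (by omega)
      (by rw [add_assoc, Nat.add_sub_cancel' hlt.le]; push_cast; linarith)
    omega

lemma countBelow_roundDown_le {u : ℕ → ℝ} {N P : ℕ} (hsucc : ∀ n, u (n + 1) = roundDown X R (u n))
    (hP : u N = u 0 + P) (t : ℝ) :
    countBelow u N (roundDown X R t) ≤ countBelow u N t + P := by
  have hshift : ∑ n ∈ Finset.range N, ⌈roundDown X R t - u (n + 1)⌉ ≤ countBelow u N t :=
    Finset.sum_le_sum fun n _ => by
      rw [Int.ceil_le, hsucc]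
      linarith [roundDown_le_roundDown_add (X := X) (R := R) (t := t) (u := u n)
        (k := ⌈t - u n⌉) (by linarith [Int.le_ceil (t - u n)])]
  have hsum := Finset.sum_range_succ' (fun n => ⌈roundDown X R t - u n⌉) N
  rw [Finset.sum_range_succ, hP, ← sub_sub, Int.ceil_sub_natCast] at hsum
  simp only [countBelow] at hshift ⊢
  omega

/-- Along a cycle `u` of `roundDown X R` modulo `ℤ`, of length `q` and translation `p`, the point
`y i` counts the points of `u + ℤ` below `X i`. The quotient `p / q` is a rotation number. -/
lemma exists_equidistributed_point (X : ι → ℝ) (hR : 0 ≤ R) :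
    ∃ (q p : ℕ) (y : ι → ℤ), 0 < q ∧ q ≤ Fintype.card ι ∧
      (∀ c : ℤ, ∃ (i : ι) (k : ℤ), y i + k * q = c) ∧
      (∀ (i j : ι) (v : ℤ), p < q * v + y i - y j → R < v + X i - X j) ∧ (p : ℝ) ≤ q * R := by
  obtain ⟨u, N, P, hN, hcard, hPR, hu, hsucc, hP, hinj⟩ := exists_roundDown_cycle X R hR
  refine ⟨N, P, fun i => countBelow u N (X i), hN, hcard, fun c => ?_, fun i j v h => ?_, hPR⟩
  · obtain ⟨a, k, hak⟩ := exists_countBelow_add_eq hN hinj c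
    obtain ⟨i, l, hil⟩ := hu a
    refine ⟨i, l + k, ?_⟩
    rw [add_mul, ← add_assoc, ← countBelow_add_intCast, ← hil, hak]
  · by_contra! hle
    have hcount := (countBelow_mono (u := u) (N := N) (le_roundDown (X := X) (R := R) (t := X j)
      (i := i) (k := v) (by linarith))).trans (countBelow_roundDown_le hsucc hP (X j))
    rw [countBelow_add_intCast] at hcount
    linarith

end RotationNumber

open Matrix.Module

section ColumnSpace

variable {R D n : Type*} [CommRing R] [Ring D] [Algebra R D] [Fintype n] [DecidableEq n]
  (A : Subalgebra R (Matrix n n D))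

/-- The `j`-th column of a matrix, as a map of left modules from an order of matrices to the space
of column vectors. -/
def columnMap (j : n) : A →ₗ[A] (n → D) where
  toFun a i := (a : Matrix n n D) i j
  map_add' _ _ := rfl
  map_smul' a b := funext fun _ =>
    Matrix.mul_apply (M := (a : Matrix n n D)) (N := (b : Matrix n n D))

/-- Right multiplication of column vectors by `d`, which commutes with the action of matrices. -/
def rightMul (d : D) : (n → D) →ₗ[A] (n → D) where
  toFun w i := w i * d
  map_add' w u := funext fun i => add_mul (w i) (u i) d
  map_smul' a w := funext fun i => by
    change (∑ j, (a : Matrix n n D) i j * w j) * d = ∑ j, (a : Matrix n n D) i j * (w j * d)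
    simp only [Finset.sum_mul, mul_assoc]

variable {A}

/-- The map `w ↦ w u` from column vectors to matrices given by a row vector `u`, on a submodule
`N` of the column space which it maps into the order `A`. -/
def vecMulVecMap {N : Submodule A (n → D)} {u : n → D}
    (h : ∀ w ∈ N, Matrix.vecMulVec w u ∈ A) : N →ₗ[A] A where
  toFun w := ⟨Matrix.vecMulVec w u, h w w.2⟩
  map_add' w w' := Subtype.ext <| Matrix.add_vecMulVec (w : n → D) w' u
  map_smul' a w := Subtype.ext (Matrix.mul_vecMulVec (a : Matrix n n D) w u).symm

lemma projective_of_vecMulVec_mem {N : Submodule A (n → D)} {u v : n → D} (hv : v ∈ N)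
    (huv : u ⬝ᵥ v = 1) (h : ∀ w ∈ N, Matrix.vecMulVec w u ∈ A) : Module.Projective A N := by
  refine .of_split (vecMulVecMap h) (LinearMap.toSpanSingleton A N ⟨v, hv⟩) ?_
  ext w i
  change ∑ j, w.1 i * u j * v j = w.1 i
  simp only [mul_assoc, ← Finset.mul_sum]
  rw [← dotProduct, huv, mul_one]

lemma projective_of_map_of_inf_ker {R M N : Type*} [Ring R] [AddCommGroup M] [Module R M]
    [AddCommGroup N] [Module R N] (f : M →ₗ[R] N) (I : Submodule R M)
    (hmap : Module.Projective R (I.map f))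
    (hker : Module.Projective R (I ⊓ f.ker : Submodule R M)) : Module.Projective R I := by
  let p : I →ₗ[R] I.map f := f.submoduleMap I
  obtain ⟨σ, hσ⟩ := p.exists_rightInverse_of_surjective
    (LinearMap.range_eq_top.2 (f.submoduleMap_surjective I))
  have hpσ : ∀ z, f (σ z) = z := fun z => congrArg Subtype.val (LinearMap.congr_fun hσ z)
  let retraction : I →ₗ[R] (I ⊓ f.ker : Submodule R M) :=
    LinearMap.codRestrict _ (I.subtype ∘ₗ (LinearMap.id - σ ∘ₗ p)) fun z =>
      ⟨Submodule.coe_mem _, by simp [hpσ, p]⟩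
  refine .of_split (retraction.prod p)
    (LinearMap.coprod (Submodule.inclusion inf_le_left) σ) ?_
  ext z
  exact sub_add_cancel (z : M) _

end ColumnSpace

section Bounds

variable {F : Type*} [Field F] [ValuativeRel F] [TopologicalSpace F]
  [IsNonarchimedeanLocalField F]
variable {D : Type*} [DivisionRing D] [Algebra F D] [FiniteDimensional F D]

lemma exists_forall_mem_ball {ι : Type*} [Finite ι] (a : ι → D) :
    ∃ k : ℤ, ∀ i, a i ∈ ball F k := by
  obtain ⟨M, hM⟩ := (Set.finite_range fun i => -valD F (a i)).bddAbove
  refine ⟨-⌈M⌉, fun i => .inr ?_⟩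
  have hle : -valD F (a i) ≤ M := hM ⟨i, rfl⟩
  have := Int.le_ceil M
  push_cast
  linarith

lemma exists_smul_forall_mem_ball {ι : Type*} [Finite ι] (a : ι → D) (k : ℤ) :
    ∃ t : F, t ≠ 0 ∧ ∀ i, t • a i ∈ ball F k := by
  obtain ⟨l, hl⟩ := exists_forall_mem_ball (F := F) a
  obtain ⟨t, ht, htk⟩ := exists_ordF_eq F (k - l)
  refine ⟨t, ht, fun i => ?_⟩
  simpa using smul_mem_ball (mem_ballF.2 (.inr htk.ge)) (hl i)

lemma integer_smul_mem_ball {t : 𝒪[F]} {a : D} {s : ℝ} (ha : a ∈ ball F s) :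
    t • a ∈ ball F s := by
  simpa [Subring.smul_def] using smul_mem_ball (mem_ballF_zero.2 t.2) ha

lemma fg_of_forall_mem_ball {n n' : Type*} [Finite n] [Finite n']
    (N : Submodule 𝒪[F] (Matrix n n' D)) (k : ℤ)
    (hN : ∀ b ∈ N, ∀ i j, b i j ∈ ball F k) : N.FG := by
  classical
  cases nonempty_fintype n
  cases nonempty_fintype n'
  let β := Module.finBasis F D
  obtain ⟨C, hC⟩ := exists_forall_repr_mem_ballF F β
  obtain ⟨t, ht, htk⟩ := exists_ordF_eq F (k - C)
  let f : n × n' × Fin (Module.finrank F D) → Matrix n n' D :=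
    fun p => Matrix.single p.1 p.2.1 (t • β p.2.2)
  refine .of_le (Submodule.fg_span (Set.finite_range f)) fun b hb => ?_
  rw [Matrix.matrix_eq_sum_single b]
  refine sum_mem fun i _ => sum_mem fun j _ => ?_
  rw [← β.sum_repr (b i j), ← Matrix.singleAddMonoidHom_apply, map_sum]
  refine sum_mem fun l _ => ?_
  have hcoeff : t⁻¹ * β.repr (b i j) l ∈ 𝒪[F] := by
    have := mul_mem_ballF (mem_ballF.2 (.inr (ordF_inv t).ge)) (hC k _ (hN b hb i j) l)
    rwa [htk, neg_add_cancel, mem_ballF_zero] at this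
  have heq : Matrix.single i j (β.repr (b i j) l • β l) =
      (⟨t⁻¹ * β.repr (b i j) l, hcoeff⟩ : 𝒪[F]) • f (i, j, l) := by
    simp only [Subring.smul_def, f]
    rw [Matrix.smul_single, smul_smul, mul_right_comm, inv_mul_cancel₀ ht, one_mul]
  rw [Matrix.singleAddMonoidHom_apply, heq]
  exact Submodule.smul_mem _ _ (Submodule.subset_span ⟨_, rfl⟩)

end Bounds

section StandardOrder

variable (F : Type*) [Field F] [ValuativeRel F] [TopologicalSpace F]
  [IsNonarchimedeanLocalField F]
variable {D : Type*} [DivisionRing D] [Algebra F D] [FiniteDimensional F D] {m : ℕ}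

/-- The hereditary order `{b | v(b_{ij}) + x_i - x_j ≥ 0}` attached to a point `x` of the standard
apartment. -/
def stdOrder (x : Fin m → ℝ) : Subalgebra 𝒪[F] (Matrix (Fin m) (Fin m) D) where
  carrier := {b | b ∈ matBall F x 0}
  mul_mem' ha hb := by simpa using mul_mem_matBall (F := F) (x := x) ha hb
  add_mem' ha hb := AddSubgroup.add_mem (matBall F x 0) ha hb
  algebraMap_mem' t := by
    rw [Algebra.algebraMap_eq_smul_one]
    exact fun i j => integer_smul_mem_ball (one_mem_matBall (F := F) i j)

variable {F} {x : Fin m → ℝ}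

lemma mem_stdOrder {b : Matrix (Fin m) (Fin m) D} :
    b ∈ stdOrder F x ↔ b ∈ matBall F x 0 := Iff.rfl

lemma smul_mem_matBall {t : F} {k : ℤ} {s : ℝ} {b : Matrix (Fin m) (Fin m) D} (ht : t ∈ ballF k)
    (hb : b ∈ matBall F x s) : t • b ∈ matBall F x (k + s) := fun i j => by
  rw [add_sub_assoc]
  exact smul_mem_ball ht (hb i j)

lemma single_one_mem_stdOrder (i : Fin m) : Matrix.single i i (1 : D) ∈ stdOrder F x :=
  mem_stdOrder.2 (single_mem_matBall (by simpa using one_mem_ball))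

lemma exists_forall_abs_sub_le {ι : Type*} [Finite ι] (x : ι → ℝ) :
    ∃ M : ℕ, ∀ i j, |x i - x j| ≤ M := by
  obtain ⟨M, hM⟩ := (Set.finite_range fun p : ι × ι => |x p.1 - x p.2|).bddAbove
  exact ⟨⌈M⌉₊, fun i j => (hM ⟨(i, j), rfl⟩).trans (Nat.le_ceil M)⟩

lemma exists_forall_mem_ball_of_mem_stdOrder (x : Fin m → ℝ) :
    ∃ k : ℤ, ∀ b ∈ stdOrder F (D := D) x, ∀ i j, b i j ∈ ball F k := by
  obtain ⟨M, hM⟩ := exists_forall_abs_sub_le x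
  refine ⟨-M, fun b hb i j => ball_antitone ?_ (mem_stdOrder.1 hb i j)⟩
  have := (abs_le.1 (hM i j)).2
  push_cast
  linarith

lemma span_stdOrder :
    Submodule.span F (stdOrder F (D := D) x : Set (Matrix (Fin m) (Fin m) D)) = ⊤ := by
  refine eq_top_iff.2 fun b _ => ?_
  obtain ⟨M, hM⟩ := exists_forall_abs_sub_le x
  obtain ⟨t, ht, htb⟩ := exists_smul_forall_mem_ball (F := F) (fun p : _ × _ => b p.1 p.2) M
  have hmem : t • b ∈ stdOrder F x := mem_stdOrder.2 fun i j => by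
    refine ball_antitone ?_ (htb (i, j))
    have := (abs_le.1 (hM i j)).1
    push_cast
    linarith
  have := Submodule.smul_mem (Submodule.span F _) t⁻¹ (Submodule.subset_span (R := F) hmem)
  rwa [smul_smul, inv_mul_cancel₀ ht, one_smul] at this

lemma single_apply_mem {N : Submodule (stdOrder F (D := D) x) (Fin m → D)} {w : Fin m → D}
    (hw : w ∈ N) (i : Fin m) : Pi.single i (w i) ∈ N := by
  have := N.smul_mem ⟨_, single_one_mem_stdOrder i⟩ hw
  change Matrix.single i i (1 : D) • w ∈ N at this
  simpa using this

lemma exists_min_of_bddBelow {ι : Type*} [Finite ι] (P : ι → ℤ → Prop) (x : ι → ℝ) {d : ℝ}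
    (hd : 0 < d) (B : ℤ) (hB : ∀ i k, P i k → B ≤ k) (hP : ∃ i k, P i k) :
    ∃ i k, P i k ∧ ∀ i' k', P i' k' → (k : ℝ) / d + x i ≤ (k' : ℝ) / d + x i' := by
  have hleast (i : {i // ∃ k, P i k}) : ∃ k, P i k ∧ ∀ k', P i k' → k ≤ k' :=
    Int.exists_least_of_bdd ⟨B, fun k hk => hB i k hk⟩ i.2
  choose κ hκ hmin using hleast
  have : Nonempty {i // ∃ k, P i k} := hP.elim fun i hi => ⟨⟨i, hi⟩⟩
  obtain ⟨i, hi⟩ := Finite.exists_min fun i : {i // ∃ k, P i k} => (κ i : ℝ) / d + x i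
  refine ⟨i, κ i, hκ i, fun i' k' h => (hi ⟨i', k', h⟩).trans ?_⟩
  have : (κ ⟨i', k', h⟩ : ℝ) ≤ k' := by exact_mod_cast hmin ⟨i', k', h⟩ k' h
  gcongr

lemma exists_forall_valD_add_le (N : Submodule (stdOrder F (D := D) x) (Fin m → D)) {K : ℤ}
    (hN : ∀ w ∈ N, ∀ i, w i ∈ ball F K) (hbot : N ≠ ⊥) :
    ∃ (i : Fin m) (c : D), c ≠ 0 ∧ Pi.single i c ∈ N ∧
      ∀ w ∈ N, ∀ j, w j ≠ 0 → valD F c + x i ≤ valD F (w j) + x j := by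
  obtain ⟨d, ϖ, hϖ⟩ := exists_isUniformizer F D
  have hd : (0 : ℝ) < d := Nat.cast_pos.2 hϖ.pos
  let P (i : Fin m) (k : ℤ) : Prop := ∃ c : D, c ≠ 0 ∧ valD F c = k / d ∧ Pi.single i c ∈ N
  have hP {w} (hw : w ∈ N) {j} (hj : w j ≠ 0) : ∃ k : ℤ, valD F (w j) = k / d ∧ P j k := by
    obtain ⟨k, hk⟩ := hϖ.exists_valD_eq _ hj
    exact ⟨k, hk, w j, hj, hk, single_apply_mem hw j⟩
  have hbdd (i k) (h : P i k) : K * d ≤ k := by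
    obtain ⟨c, hc, hk, hcN⟩ := h
    have := hN _ hcN i
    rw [Pi.single_eq_same, mem_ball_of_ne_zero hc, hk, le_div_iff₀ hd] at this
    exact_mod_cast this
  obtain ⟨w, hw, hw0⟩ := N.ne_bot_iff.1 hbot
  obtain ⟨i, hi⟩ := Function.ne_iff.1 hw0
  obtain ⟨k, -, hik⟩ := hP hw hi
  obtain ⟨i₀, k₀, ⟨c, hc, hck, hcN⟩, hmin⟩ := exists_min_of_bddBelow P x hd _ hbdd ⟨i, k, hik⟩
  refine ⟨i₀, c, hc, hcN, fun w hw j hj => ?_⟩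
  obtain ⟨k', hk', hPj⟩ := hP hw hj
  rw [hck, hk']
  exact hmin j k' hPj

lemma projective_of_forall_mem_ball (N : Submodule (stdOrder F (D := D) x) (Fin m → D)) (K : ℤ)
    (hN : ∀ w ∈ N, ∀ i, w i ∈ ball F K) : Module.Projective (stdOrder F (D := D) x) N := by
  rcases eq_or_ne N ⊥ with rfl | hbot
  · infer_instance
  obtain ⟨i₀, c, hc, hcN, hmin⟩ := exists_forall_valD_add_le N hN hbot
  refine projective_of_vecMulVec_mem (u := Pi.single i₀ c⁻¹) hcN ?_ fun w hw => ?_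
  · simp [hc]
  refine mem_stdOrder.2 fun j l => ?_
  rw [Matrix.vecMulVec_apply]
  rcases eq_or_ne l i₀ with rfl | hl
  · rw [Pi.single_eq_same]
    by_cases hwj : w j = 0
    · simp [hwj]
    rw [mem_ball_of_ne_zero (mul_ne_zero hwj (inv_ne_zero hc)), valD_mul hwj (inv_ne_zero hc),
      valD_inv hc]
    linarith [hmin w hw j hwj]
  · simp [hl]

/-- Induction on the number of columns on which `I` is supported. -/
lemma projective_of_forall_column_eq_zero (s : ℕ) (I : Ideal (stdOrder F (D := D) x))
    (hI : ∀ a ∈ I, ∀ i (j : Fin m), s ≤ (j : ℕ) → (a : Matrix (Fin m) (Fin m) D) i j = 0) :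
    Module.Projective (stdOrder F (D := D) x) I := by
  induction s generalizing I with
  | zero =>
    obtain rfl : I = ⊥ := (Submodule.eq_bot_iff _).2 fun a ha => Subtype.ext <|
      Matrix.ext fun i j => hI a ha i j (Nat.zero_le _)
    infer_instance
  | succ s ih =>
    by_cases hs : s < m
    · refine projective_of_map_of_inf_ker (columnMap _ ⟨s, hs⟩) I ?_ (ih _ ?_)
      · obtain ⟨K, hK⟩ := exists_forall_mem_ball_of_mem_stdOrder (F := F) (D := D) x
        refine projective_of_forall_mem_ball _ K ?_
        rintro _ ⟨a, _, rfl⟩ i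
        exact hK a a.2 i _
      · rintro a ⟨ha, hker⟩ i j hj
        rcases hj.eq_or_lt with rfl | hlt
        · exact congrFun (LinearMap.mem_ker.1 hker) i
        · exact hI a ha i j hlt
    · exact ih I fun _ _ _ j _ => absurd j.2 (by omega)

lemma isHereditaryOrder_stdOrder : IsHereditaryOrder F (stdOrder F (D := D) x) where
  fg := (exists_forall_mem_ball_of_mem_stdOrder x).elim fun k hk => fg_of_forall_mem_ball _ k hk
  span_eq_top := span_stdOrder
  projective I := projective_of_forall_column_eq_zero m I fun _ _ _ j h => absurd j.2 h.not_gt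

variable (F D) in
/-- The coordinates of `x` are equidistributed modulo the value group of `D` with spacing `ε`: the
affine roots take at `x` no value strictly between `0` and `ε`, and for each column `j` some affine
root `v(d) + x_l - x_j` takes the value `ε`. -/
structure IsEquidistributed (x : Fin m → ℝ) (ε : ℝ) : Prop where
  pos : 0 < ε
  exists_eq : ∀ j, ∃ (l : Fin m) (d : D), d ≠ 0 ∧ valD F d + (x l - x j) = ε
  le_of_pos : ∀ (i j : Fin m) (d : D), d ≠ 0 → 0 < valD F d + (x i - x j) →
    ε ≤ valD F d + (x i - x j)

lemma eq_zero_of_mem_jacobson_of_isIdempotentElem {R : Type*} [Ring R] {e : R}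
    (he : IsIdempotentElem e) (hmem : e ∈ Ring.jacobson R) : e = 0 := by
  rw [← Ideal.jacobson_bot, Ideal.mem_jacobson_iff] at hmem
  obtain ⟨z, hz⟩ := hmem (-1)
  have hinv : z * (1 - e) = 1 := by
    rw [Submodule.mem_bot, sub_eq_zero] at hz
    rw [mul_sub, mul_one, sub_eq_neg_add, ← hz, mul_neg_one, neg_mul]
  calc e = z * (1 - e) * e := by rw [hinv, one_mul]
    _ = 0 := by rw [mul_assoc, sub_mul, one_mul, he, sub_self, mul_zero]

variable {ε : ℝ}

/-- Otherwise an entry of `a` could be moved to a diagonal idempotent by multiplication within the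
order. -/
lemma mem_matBall_of_mem_jacobson (hx : IsEquidistributed F D x ε) {a : stdOrder F (D := D) x}
    (ha : a ∈ Ring.jacobson (stdOrder F (D := D) x)) :
    (a : Matrix (Fin m) (Fin m) D) ∈ matBall F x ε := by
  intro i j
  set c := (a : Matrix (Fin m) (Fin m) D) i j with hc
  by_contra hcon
  obtain ⟨hc0, hlt⟩ : c ≠ 0 ∧ valD F c < ε - (x i - x j) := by
    simpa only [mem_ball, not_or, not_le] using hcon
  have hle : valD F c + (x i - x j) ≤ 0 := by
    by_contra! hpos
    linarith [hx.le_of_pos i j _ hc0 hpos]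
  have hmem : Matrix.single j i c⁻¹ ∈ stdOrder F x := mem_stdOrder.2 <| single_mem_matBall <| by
    rw [mem_ball_of_ne_zero (inv_ne_zero hc0), valD_inv hc0]
    linarith
  let e : stdOrder F (D := D) x := ⟨_, single_one_mem_stdOrder i⟩
  have he : e * (a * ⟨_, hmem⟩) = e := Subtype.ext <| by
    change Matrix.single i i 1 * ((a : Matrix (Fin m) (Fin m) D) * Matrix.single j i c⁻¹) =
      Matrix.single i i 1
    rw [← mul_assoc, Matrix.single_mul_mul_single, ← hc, one_mul, mul_inv_cancel₀ hc0]
  have hidem : IsIdempotentElem e := Subtype.ext <| by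
    change Matrix.single i i (1 : D) * Matrix.single i i 1 = Matrix.single i i 1
    rw [Matrix.single_mul_single_same, one_mul]
  have he0 := eq_zero_of_mem_jacobson_of_isIdempotentElem hidem <|
    he ▸ Ideal.mul_mem_left _ e (Ideal.mul_mem_right _ _ ha)
  simpa [e] using congrFun (congrFun (congrArg Subtype.val he0) i) i

lemma mem_jacobson_of_mem_matBall (hε : 0 < ε) {a : stdOrder F (D := D) x}
    (ha : (a : Matrix (Fin m) (Fin m) D) ∈ matBall F x ε) :
    a ∈ Ring.jacobson (stdOrder F (D := D) x) := by
  rw [← Ideal.jacobson_bot, Ideal.mem_jacobson_iff]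
  intro y
  have hya : (y * a : Matrix (Fin m) (Fin m) D) ∈ matBall F x ε := by
    simpa using mul_mem_matBall (mem_stdOrder.1 y.2) ha
  obtain ⟨g, hg, hge⟩ := exists_mem_moyPrasadStd_eq_one_add_of_forall_notMem hε Finset.univ hya
    (by simp)
  have hinv : ((g⁻¹ : GLD D m) : Matrix (Fin m) (Fin m) D) ∈ stdOrder F x := by
    have := add_mem (matBall_antitone hε.le
      (moyPrasadStd_le_congruenceSubgroup hε.le hg).2) one_mem_matBall
    rwa [sub_add_cancel] at this
  refine ⟨⟨_, hinv⟩, (Submodule.mem_bot _).2 (Subtype.ext ?_)⟩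
  change ((g⁻¹ : GLD D m) : Matrix (Fin m) (Fin m) D) * y * a + (g⁻¹ : GLD D m) - 1 = 0
  have hya_eq : (y : Matrix (Fin m) (Fin m) D) * a = g - 1 := eq_sub_of_add_eq' hge.symm
  rw [mul_assoc, hya_eq, mul_sub, Units.inv_mul, mul_one, sub_add_cancel, sub_self]

lemma mem_jacobson_stdOrder (hx : IsEquidistributed F D x ε) {a : stdOrder F (D := D) x} :
    a ∈ Ring.jacobson (stdOrder F (D := D) x) ↔
      (a : Matrix (Fin m) (Fin m) D) ∈ matBall F x ε :=
  ⟨mem_matBall_of_mem_jacobson hx, mem_jacobson_of_mem_matBall hx.pos⟩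

lemma exists_single_eq_mul (hx : IsEquidistributed F D x ε) {s : ℝ} {i j : Fin m} {c : D}
    (hc : c ∈ ball F (s + ε - (x i - x j))) :
    ∃ a ∈ matBall F x s, ∃ b ∈ matBall F x ε, Matrix.single i j c = a * b := by
  obtain ⟨l, d, hd, hl⟩ := hx.exists_eq j
  have hcd : c * d⁻¹ ∈ ball F (s - (x i - x l)) := by
    refine ball_antitone ?_ (mul_mem_ball hc ((mem_ball_of_ne_zero (inv_ne_zero hd)).2
      (valD_inv hd).ge))
    linarith
  refine ⟨_, single_mem_matBall hcd, Matrix.single l j d,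
    single_mem_matBall (.inr (by linarith)), ?_⟩
  rw [Matrix.single_mul_single_same, inv_mul_cancel_right₀ hd]

lemma mem_jacobson_pow_stdOrder (hx : IsEquidistributed F D x ε) (k : ℕ)
    {a : stdOrder F (D := D) x} :
    a ∈ Ring.jacobson (stdOrder F (D := D) x) ^ k ↔
      (a : Matrix (Fin m) (Fin m) D) ∈ matBall F x (k * ε) := by
  induction k generalizing a with
  | zero => simpa [Submodule.pow_zero, Ideal.one_eq_top] using mem_stdOrder.1 a.2
  | succ k ih =>
    have hε := hx.pos
    rw [Submodule.pow_succ, Nat.cast_succ, add_one_mul]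
    refine ⟨fun ha => ?_, fun ha => ?_⟩
    · induction ha using Submodule.mul_induction_on' with
      | mem_mul_mem p hp q hq => exact mul_mem_matBall (ih.1 hp) ((mem_jacobson_stdOrder hx).1 hq)
      | add p _ q _ hp hq => exact add_mem hp hq
    · have hsingle (i j) : Matrix.single i j ((a : Matrix (Fin m) (Fin m) D) i j) ∈ stdOrder F x :=
        mem_stdOrder.2 <| matBall_antitone (by positivity) (single_mem_matBall (ha i j))
      have hsum : a = ∑ i, ∑ j, ⟨_, hsingle i j⟩ := Subtype.ext <| by
        simpa using Matrix.matrix_eq_sum_single (a : Matrix (Fin m) (Fin m) D)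
      rw [hsum]
      refine sum_mem fun i _ => sum_mem fun j _ => ?_
      obtain ⟨b, hb, c, hc, hbc⟩ := exists_single_eq_mul hx (ha i j)
      have hb0 : b ∈ stdOrder F x := mem_stdOrder.2 (matBall_antitone (by positivity) hb)
      have hc0 : c ∈ stdOrder F x := mem_stdOrder.2 (matBall_antitone hε.le hc)
      have hprod : (⟨_, hsingle i j⟩ : stdOrder F (D := D) x) = ⟨b, hb0⟩ * ⟨c, hc0⟩ :=
        Subtype.ext hbc
      exact hprod ▸ Submodule.mul_mem_mul (ih.2 hb) ((mem_jacobson_stdOrder hx).2 hc)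

lemma isRamificationIndex_stdOrder (hx : IsEquidistributed F D x ε) {e : ℕ} (he : e * ε = 1) :
    IsRamificationIndex F (stdOrder F (D := D) x) e := by
  refine le_antisymm (Ideal.map_le_iff_le_comap.2 fun t ht => ?_) fun a ha => ?_
  · rw [Ideal.mem_comap, mem_jacobson_pow_stdOrder hx, he]
    change algebraMap 𝒪[F] (Matrix (Fin m) (Fin m) D) t ∈ _
    rw [Algebra.algebraMap_eq_smul_one]
    simpa [Subring.smul_def] using smul_mem_matBall (mem_maximalIdeal_iff.1 ht)
      (one_mem_matBall (F := F) (D := D))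
  · rw [mem_jacobson_pow_stdOrder hx, he] at ha
    obtain ⟨t, ht, ht1⟩ := exists_ordF_eq F 1
    have htO : t ∈ 𝒪[F] := mem_ballF_zero.1 (mem_ballF.2 (.inr (by omega)))
    have hb : t⁻¹ • (a : Matrix (Fin m) (Fin m) D) ∈ stdOrder F x := mem_stdOrder.2 <| by
      simpa [ht1] using smul_mem_matBall (mem_ballF.2 (.inr (ordF_inv t).ge)) ha
    have hmul : a = ⟨_, hb⟩ * algebraMap 𝒪[F] (stdOrder F (D := D) x) ⟨t, htO⟩ := by
      rw [Algebra.algebraMap_eq_smul_one, mul_smul_one]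
      refine Subtype.ext ?_
      change (a : Matrix (Fin m) (Fin m) D) = t • t⁻¹ • (a : Matrix (Fin m) (Fin m) D)
      rw [smul_inv_smul₀ ht]
    rw [hmul]
    exact Ideal.mul_mem_left _ _ (Ideal.mem_map_of_mem _ (mem_maximalIdeal_iff.2
      (mem_ballF.2 (.inr ht1.ge))))

end StandardOrder

section Conjugation

lemma map_mem_jacobson_pow {R S : Type*} [Ring R] [Ring S] {f : R →+* S}
    (hf : Function.Surjective f) (k : ℕ) {a : R} (ha : a ∈ Ring.jacobson R ^ k) :
    f a ∈ Ring.jacobson S ^ k := by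
  have : RingHomSurjective f := ⟨hf⟩
  induction k generalizing a with
  | zero => simp [Submodule.pow_zero, Ideal.one_eq_top]
  | succ k ih =>
    rw [Submodule.pow_succ] at *
    induction ha using Submodule.mul_induction_on' with
    | mem_mul_mem p hp q hq =>
      rw [map_mul]
      exact Submodule.mul_mem_mul (ih hp) (Ring.le_comap_jacobson f hq)
    | add p _ q _ hp hq => rw [map_add]; exact add_mem hp hq

variable {F : Type*} [Field F] [ValuativeRel F]
variable {D : Type*} [DivisionRing D] [Algebra F D] {m : ℕ}

variable (F) in
/-- The inner automorphism `b ↦ g b g⁻¹` of the algebra `M_m(D)`. -/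
def conjMatrix (g : GLD D m) : Matrix (Fin m) (Fin m) D ≃ₐ[F] Matrix (Fin m) (Fin m) D :=
  MulSemiringAction.toAlgEquiv F _ (ConjAct.toConjAct g)

/-- The conjugate `g A g⁻¹` of an order `A`. -/
def conjOrder (g : GLD D m) (A : Subalgebra 𝒪[F] (Matrix (Fin m) (Fin m) D)) :
    Subalgebra 𝒪[F] (Matrix (Fin m) (Fin m) D) :=
  A.map ((conjMatrix F g).restrictScalars 𝒪[F]).toAlgHom

/-- The isomorphism `b ↦ g b g⁻¹` of an order with its conjugate. -/
def conjOrderEquiv (g : GLD D m) (A : Subalgebra 𝒪[F] (Matrix (Fin m) (Fin m) D)) :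
    A ≃ₐ[𝒪[F]] conjOrder g A :=
  ((conjMatrix F g).restrictScalars 𝒪[F]).subalgebraMap A

variable (g : GLD D m) {A : Subalgebra 𝒪[F] (Matrix (Fin m) (Fin m) D)}

lemma coe_conjOrderEquiv (a : A) : (conjOrderEquiv g A a : Matrix (Fin m) (Fin m) D) =
    g * (a : Matrix (Fin m) (Fin m) D) * (g⁻¹ : GLD D m) := rfl

lemma isHereditaryOrder_conjOrder (hA : IsHereditaryOrder F A) :
    IsHereditaryOrder F (conjOrder g A) where
  fg := by
    rw [conjOrder, Subalgebra.map_toSubmodule]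
    exact hA.fg.map _
  span_eq_top := by
    change Submodule.span F ((conjMatrix F g).toLinearMap '' A) = ⊤
    rw [Submodule.span_image, hA.span_eq_top, Submodule.map_top, LinearMap.range_eq_top]
    exact (conjMatrix F g).surjective
  projective I := by
    let e := (conjOrderEquiv g A).toRingEquiv
    have := hA.projective (I.comap e)
    have : RingHomInvPair (e : A →+* conjOrder g A) (e.symm : conjOrder g A →+* A) :=
      RingHomInvPair.of_ringEquiv _
    have : RingHomInvPair (e.symm : conjOrder g A →+* A) (e : A →+* conjOrder g A) :=
      RingHomInvPair.symm _ _
    let eI : I.comap e ≃ₛₗ[(e : A →+* conjOrder g A)] I :=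
      { toFun a := ⟨e a, a.2⟩
        invFun a := ⟨e.symm a, by
          rw [Ideal.mem_comap, RingEquiv.apply_symm_apply]
          exact a.2⟩
        left_inv a := Subtype.ext (e.symm_apply_apply _)
        right_inv a := Subtype.ext (e.apply_symm_apply _)
        map_add' a b := Subtype.ext (map_add e _ _)
        map_smul' a b := Subtype.ext (map_mul e _ _) }
    exact .of_equiv eI

lemma isRamificationIndex_conjOrder {n : ℕ} (hA : IsRamificationIndex F A n) :
    IsRamificationIndex F (conjOrder g A) n := by
  let e := (conjOrderEquiv g A).toRingEquiv
  have halg : algebraMap 𝒪[F] (conjOrder g A) =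
      (e : A →+* conjOrder g A).comp (algebraMap 𝒪[F] A) :=
    RingHom.ext fun t => ((conjOrderEquiv g A).commutes t).symm
  rw [IsRamificationIndex, halg, ← Ideal.map_map, hA]
  refine le_antisymm (Ideal.map_le_iff_le_comap.2 fun a ha => ?_) fun a ha => ?_
  · exact map_mem_jacobson_pow (f := (e : A →+* conjOrder g A)) e.surjective n ha
  · have := map_mem_jacobson_pow (f := (e.symm : conjOrder g A →+* A)) e.symm.surjective n ha
    simpa using Ideal.mem_map_of_mem (e : A →+* conjOrder g A) this

lemma conj_mem_unitFiltration {j : ℕ} {h : GLD D m}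
    (hh : h ∈ unitFiltration F (conjOrder g A) (j + 1)) :
    g⁻¹ * h * g ∈ unitFiltration F A (j + 1) := by
  obtain ⟨a, ha, hha⟩ := hh
  let e := conjOrderEquiv g A
  refine ⟨e.symm a, map_mem_jacobson_pow (f := (e.toRingEquiv.symm : _ →+* A))
    e.symm.surjective _ ha, ?_⟩
  have haconj : (a : Matrix (Fin m) (Fin m) D) =
      g * (e.symm a : Matrix (Fin m) (Fin m) D) * (g⁻¹ : GLD D m) := by
    rw [← coe_conjOrderEquiv, AlgEquiv.apply_symm_apply]
  rw [Units.val_mul, Units.val_mul, hha, haconj, mul_add, add_mul, mul_one, Units.inv_mul]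
  simp only [mul_assoc, Units.inv_mul_cancel_left, Units.inv_mul, mul_one]

end Conjugation

section OrderOfPoint

variable {F : Type*} [Field F] [ValuativeRel F] [TopologicalSpace F]
  [IsNonarchimedeanLocalField F]
variable {D : Type*} [DivisionRing D] [Algebra F D]

lemma valD_add_intCast_div {d q : ℕ} (hd : d ≠ 0) (hq : q ≠ 0) {a : D} {k : ℤ}
    (hk : valD F a = k / d) (u w : ℤ) :
    valD F a + ((u : ℝ) / (q * d) - w / (q * d)) =
      ((q * k + u - w : ℤ) : ℝ) * (1 / (q * d)) := by
  rw [hk]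
  push_cast
  field_simp
  ring

variable {m : ℕ}

lemma mem_moyPrasad_iff {g h : GLD D m} {x : Fin m → ℝ} {s : ℝ} :
    h ∈ moyPrasad F D g x s ↔ g⁻¹ * h * g ∈ moyPrasadStd F D x s := by
  constructor
  · rintro ⟨k, hk, rfl⟩
    simpa [mul_assoc] using hk
  · exact fun hh => ⟨_, hh, by simp [mul_assoc]⟩

lemma isEquidistributed_intCast_div {d : ℕ} {ϖ : D} (hϖ : IsUniformizer F d ϖ) {q : ℕ}
    (hq : 0 < q) {y : Fin m → ℤ} (hy : ∀ c : ℤ, ∃ i k, y i + k * q = c) :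
    IsEquidistributed F D (fun i => (y i : ℝ) / (q * d)) (1 / (q * d)) where
  pos := by
    have := hϖ.pos
    positivity
  exists_eq j := by
    obtain ⟨l, k, hlk⟩ := hy (y j + 1)
    have hval : valD F (ϖ ^ k) = k / d := by rw [valD_zpow hϖ.ne_zero, hϖ.valD_eq, mul_one_div]
    refine ⟨l, ϖ ^ k, zpow_ne_zero _ hϖ.ne_zero, ?_⟩
    rw [valD_add_intCast_div hϖ.pos.ne' hq.ne' hval, show (q * k + y l - y j : ℤ) = 1 by linarith]
    simp
  le_of_pos i j a ha hpos := by
    obtain ⟨k, hk⟩ := hϖ.exists_valD_eq a ha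
    rw [valD_add_intCast_div hϖ.pos.ne' hq.ne' hk] at *
    have : (0 : ℤ) < q * k + y i - y j := by
      exact_mod_cast pos_of_mul_pos_left hpos (by positivity)
    exact le_mul_of_one_le_left (by positivity) (by exact_mod_cast this)

variable [FiniteDimensional F D]

lemma exists_lt_mem_matBall {x : Fin m → ℝ} {r : ℝ} {b : Matrix (Fin m) (Fin m) D}
    (hb : ∀ i j, b i j ≠ 0 → r < valD F (b i j) + (x i - x j)) :
    ∃ s, r < s ∧ b ∈ matBall F x s := by
  have hnear : ∀ᶠ s in nhdsWithin r (Set.Ioi r), ∀ i j, b i j ∈ ball F (s - (x i - x j)) := by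
    refine Filter.eventually_all.2 fun i => Filter.eventually_all.2 fun j => ?_
    rcases eq_or_ne (b i j) 0 with h0 | h0
    · exact .of_forall fun s => .inl h0
    · filter_upwards [Ioo_mem_nhdsGT (hb i j h0)] with s hs
      exact .inr (by linarith [hs.2])
  obtain ⟨s, hs, hrs⟩ := (hnear.and self_mem_nhdsWithin).exists
  exact ⟨s, hrs, hs⟩

lemma exists_lt_mem_matBall_of_mem_matBall {d : ℕ} {ϖ : D} (hϖ : IsUniformizer F d ϖ) {q p : ℕ}
    (hq : 0 < q) {x : Fin m → ℝ} {r : ℝ} {y : Fin m → ℤ}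
    (hlt : ∀ i j (v : ℤ), p < q * v + y i - y j → d * r < v + d * x i - d * x j)
    {b : Matrix (Fin m) (Fin m) D}
    (hb : b ∈ matBall F (fun i => (y i : ℝ) / (q * d)) ((p + 1 : ℕ) * (1 / (q * d)))) :
    ∃ s, r < s ∧ b ∈ matBall F x s := by
  have hd : (0 : ℝ) < d := Nat.cast_pos.2 hϖ.pos
  refine exists_lt_mem_matBall fun i j hij => ?_
  obtain ⟨k, hk⟩ := hϖ.exists_valD_eq _ hij
  have hball := (mem_ball_of_ne_zero hij).1 (hb i j)
  rw [sub_le_iff_le_add, valD_add_intCast_div hϖ.pos.ne' hq.ne' hk] at hball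
  have hle : ((p + 1 : ℕ) : ℤ) ≤ q * k + y i - y j := by
    exact_mod_cast le_of_mul_le_mul_right hball (by positivity)
  have hmul : d * (valD F (b i j) + (x i - x j)) = k + d * x i - d * x j := by
    rw [hk, mul_add, mul_div_cancel₀ _ hd.ne']
    ring
  exact lt_of_mul_lt_mul_left (hmul ▸ hlt i j k (by push_cast at hle; omega)) hd.le

lemma exists_isHereditaryOrder_unitFiltration_subset (hm : 0 < m) {d : ℕ} {ϖ : D}
    (hϖ : IsUniformizer F d ϖ) (g : GLD D m) (x : Fin m → ℝ) {r : ℝ} (hr : 0 ≤ r) :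
    ∃ (A : Subalgebra 𝒪[F] (Matrix (Fin m) (Fin m) D)) (q p : ℕ), 0 < q ∧ q ≤ m ∧
      IsHereditaryOrder F A ∧ IsRamificationIndex F A (q * d) ∧
      unitFiltration F A (p + 1) ⊆ moyPrasadPlus F D g x r ∧
      (p : ℝ) / ((q * d : ℕ) : ℝ) ≤ r := by
  have : Nonempty (Fin m) := ⟨⟨0, hm⟩⟩
  have hd : (0 : ℝ) < d := Nat.cast_pos.2 hϖ.pos
  obtain ⟨q, p, y, hq, hqm, hy, hlt, hpr⟩ := exists_equidistributed_point
    (fun i => d * x i) (R := d * r) (by positivity)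
  have hz := isEquidistributed_intCast_div hϖ hq hy
  refine ⟨conjOrder g (stdOrder F _), q, p, hq, by simpa using hqm,
    isHereditaryOrder_conjOrder g isHereditaryOrder_stdOrder,
    isRamificationIndex_conjOrder g (isRamificationIndex_stdOrder hz ?_), fun h hh => ?_, ?_⟩
  · push_cast
    field_simp
  · obtain ⟨a, ha, hha⟩ := conj_mem_unitFiltration g hh
    obtain ⟨s, hrs, hs⟩ := exists_lt_mem_matBall_of_mem_matBall hϖ hq hlt
      ((mem_jacobson_pow_stdOrder hz _).1 ha)
    refine Set.mem_iUnion₂.2 ⟨s, hrs, mem_moyPrasad_iff.2 ?_⟩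
    rwa [mem_moyPrasadStd_iff (hr.trans_lt hrs), hha, add_sub_cancel_left]
  · push_cast
    rw [div_le_iff₀ (by positivity)]
    linarith

end OrderOfPoint

section Smooth

variable (F : Type*) [Field F] [ValuativeRel F] [TopologicalSpace F]
  [IsNonarchimedeanLocalField F]
variable {D : Type*} [DivisionRing D] [Algebra F D] [FiniteDimensional F D]
  [TopologicalSpace D] [IsModuleTopology F D] {m : ℕ}

lemma exists_matBall_subset_of_mem_nhds (a : Matrix (Fin m) (Fin m) D)
    {s : Set (Matrix (Fin m) (Fin m) D)} (hs : s ∈ nhds a) :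
    ∃ k : ℕ, ∀ b, b - a ∈ matBall F (0 : Fin m → ℝ) k → b ∈ s := by
  let β := Module.finBasis F D
  obtain ⟨C, hC⟩ := exists_forall_repr_mem_ballF F β
  have : ContinuousAdd D := IsModuleTopology.toContinuousAdd F D
  have : ContinuousSMul F D := IsModuleTopology.toContinuousSMul F D
  let f (c : Fin m × Fin m × Fin (Module.finrank F D) → F) : Matrix (Fin m) (Fin m) D :=
    Matrix.of fun i j => a i j + ∑ l, c (i, j, l) • β l
  have hf : Continuous f := continuous_matrix fun i j => by
    simp only [f, Matrix.of_apply]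
    fun_prop
  have hf0 : f 0 = a := by ext i j; simp [f]
  have hpre : f ⁻¹' s ∈ nhds 0 := hf.continuousAt.preimage_mem_nhds (hf0.symm ▸ hs)
  rw [nhds_pi, Filter.mem_pi'] at hpre
  obtain ⟨I, t, ht, hts⟩ := hpre
  choose κ hκ using fun p => exists_ballF_subset (ht p)
  obtain ⟨M, hM⟩ := (Set.finite_range κ).bddAbove
  refine ⟨(M + C).toNat, fun b hb => ?_⟩
  let c (p : Fin m × Fin m × Fin (Module.finrank F D)) : F :=
    β.repr (b p.1 p.2.1 - a p.1 p.2.1) p.2.2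
  have hc : c ∈ Set.pi (I : Set _) t := fun p _ => hκ p <| by
    have hentry : b p.1 p.2.1 - a p.1 p.2.1 ∈ ball F (((M + C).toNat : ℤ) : ℝ) := by
      simpa only [Int.cast_natCast, Pi.zero_apply, sub_zero, Matrix.sub_apply] using hb p.1 p.2.1
    refine ballF_antitone ?_ (hC _ _ hentry p.2.2)
    have := hM ⟨p, rfl⟩
    omega
  have hfc : f c = b := by
    ext i j
    simp only [f, c, Matrix.of_apply, β.sum_repr, add_sub_cancel]
  exact hfc ▸ hts hc

lemma exists_moyPrasadPlus_subset_of_mem_nhds_one {U : Set (GLD D m)} (hU : U ∈ nhds 1) :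
    ∃ r : ℝ, 0 ≤ r ∧ moyPrasadPlus F D 1 0 r ⊆ U := by
  rw [Units.isEmbedding_embedProduct.isInducing.nhds_eq_comap, Filter.mem_comap] at hU
  obtain ⟨O, hO, hOU⟩ := hU
  rw [map_one, Prod.one_eq_mk, nhds_prod_eq, Filter.mem_prod_iff] at hO
  obtain ⟨O₁, hO₁, O₂, hO₂, hO⟩ := hO
  obtain ⟨k₁, hk₁⟩ := exists_matBall_subset_of_mem_nhds F _ hO₁
  obtain ⟨k₂, hk₂⟩ := exists_matBall_subset_of_mem_nhds F _
    (MulOpposite.continuous_op.continuousAt.preimage_mem_nhds hO₂)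
  have hk : (0 : ℝ) ≤ max (k₁ : ℝ) k₂ := le_max_of_le_left (Nat.cast_nonneg k₁)
  refine ⟨_, hk, fun h hh => ?_⟩
  obtain ⟨s, hs, hhs⟩ := Set.mem_iUnion₂.1 hh
  have hcong := moyPrasadStd_le_congruenceSubgroup (hk.trans hs.le)
    (by simpa using mem_moyPrasad_iff.1 hhs : h ∈ moyPrasadStd F D 0 s)
  exact hOU <| hO ⟨hk₁ _ (matBall_antitone ((le_max_left _ _).trans hs.le) hcong.1),
    hk₂ _ (matBall_antitone ((le_max_right _ _).trans hs.le) hcong.2)⟩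

lemma exists_hasFixedVector_moyPrasadPlus {H : Subgroup (GLD D m)} {V : Type*} [AddCommGroup V]
    [Module ℂ V] [Nontrivial V] {π : Representation ℂ H V} (hπ : IsSmooth π) :
    ∃ r : ℝ, 0 ≤ r ∧ HasFixedVector π (moyPrasadPlus F D 1 0 r) := by
  obtain ⟨v, hv⟩ := exists_ne (0 : V)
  obtain ⟨U, hU, hUv⟩ := isOpen_induced_iff.1 (hπ v)
  have hfix (h : H) : (h : GLD D m) ∈ U ↔ π h v = v := Set.ext_iff.1 hUv h
  obtain ⟨r, hr, hrU⟩ := exists_moyPrasadPlus_subset_of_mem_nhds_one F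
    (hU.mem_nhds ((hfix 1).2 (by simp)))
  exact ⟨r, hr, v, hv, fun h hh => (hfix h).1 (hrU hh)⟩

end Smooth

section Jacobson

variable {R M : Type*} [Ring R] [AddCommGroup M] [Module R M]
  [IsSemisimpleRing (R ⧸ Ring.jacobson R)]

lemma isSemisimpleModule_quotient_jacobson_smul :
    IsSemisimpleModule R (M ⧸ (Ring.jacobson R • ⊤ : Submodule R M)) := by
  have htors : Module.IsTorsionBySet R (M ⧸ (Ring.jacobson R • ⊤ : Submodule R M))
      (Ring.jacobson R) :=
    (Module.isTorsionBySet_quotient_iff _ _).2 fun m i hi => Submodule.smul_mem_smul hi trivial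
  let _ := htors.module
  exact htors.isSemisimpleModule_iff.1 inferInstance

lemma le_jacobson_smul_top_of_ne_top
    (hM : ∀ N N' : Submodule R M, N ⊔ N' = ⊤ → N = ⊤ ∨ N' = ⊤) {N : Submodule R M}
    (hN : N ≠ ⊤) : N ≤ Ring.jacobson R • ⊤ := by
  have := isSemisimpleModule_quotient_jacobson_smul (R := R) (M := M)
  set q := (Ring.jacobson R • ⊤ : Submodule R M).mkQ
  have hq : Function.Surjective q := Submodule.mkQ_surjective _
  obtain ⟨C, hC⟩ := exists_isCompl (N.map q)
  have hsup : N ⊔ C.comap q = ⊤ := by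
    rw [← Submodule.comap_map_eq_self ((LinearMap.ker_le_comap q).trans le_sup_right),
      Submodule.map_sup, Submodule.map_comap_eq_of_surjective hq, hC.sup_eq_top,
      Submodule.comap_top]
  have hCtop : C = ⊤ := by
    rw [← Submodule.map_comap_eq_of_surjective hq C, (hM _ _ hsup).resolve_left hN,
      Submodule.map_top, LinearMap.range_eq_top.2 hq]
  rw [hCtop] at hC
  rw [← Submodule.ker_mkQ (Ring.jacobson R • ⊤ : Submodule R M)]
  exact LinearMap.le_ker_iff_map.2 (eq_bot_of_isCompl_top hC)

end Jacobson

section RightMul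

variable {R D n : Type*} [CommRing R] [Ring D] [Algebra R D] [Fintype n] [DecidableEq n]
  {A : Subalgebra R (Matrix n n D)}

lemma rightMul_apply (d : D) (w : n → D) (i : n) : rightMul A d w i = w i * d := rfl

lemma rightMul_rightMul (d d' : D) (w : n → D) :
    rightMul A d' (rightMul A d w) = rightMul A (d * d') w :=
  funext fun i => mul_assoc (w i) d d'

lemma rightMul_smul (d : D) (t : R) (w : n → D) :
    rightMul A d (t • w) = t • rightMul A d w :=
  funext fun i => smul_mul_assoc t (w i) d

lemma rightMul_one (w : n → D) : rightMul A 1 w = w := funext fun i => mul_one (w i)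

lemma map_rightMul_map_rightMul (d d' : D) (N : Submodule A (n → D)) :
    (N.map (rightMul A d)).map (rightMul A d') = N.map (rightMul A (d * d')) :=
  (Submodule.map_comp (rightMul A d) (rightMul A d') N).symm.trans <|
    congrArg (Submodule.map · N) (LinearMap.ext (rightMul_rightMul d d'))

lemma map_rightMul_one (N : Submodule A (n → D)) : N.map (rightMul A 1) = N :=
  (congrArg (Submodule.map · N) (LinearMap.ext rightMul_one)).trans (Submodule.map_id N)

lemma vecMulVec_smul {w u : n → D} (h : Matrix.vecMulVec w u ∈ A) (v : n → D) :
    (⟨_, h⟩ : A) • v = rightMul A (u ⬝ᵥ v) w := by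
  ext i
  change ∑ j, w i * u j * v j = w i * ∑ j, u j * v j
  simp only [Finset.mul_sum, mul_assoc]

end RightMul

section HereditaryOrder

variable {F : Type*} [Field F] [ValuativeRel F]
variable {D : Type*} [DivisionRing D] [Algebra F D] {m : ℕ}
variable {A : Subalgebra 𝒪[F] (Matrix (Fin m) (Fin m) D)}

lemma IsHereditaryOrder.exists_smul_mem (hA : IsHereditaryOrder F A)
    (b : Matrix (Fin m) (Fin m) D) : ∃ t : 𝒪[F], t ≠ 0 ∧ t • b ∈ A := by
  have hb : b ∈ Submodule.span F (A : Set (Matrix (Fin m) (Fin m) D)) :=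
    hA.span_eq_top ▸ Submodule.mem_top
  obtain ⟨a, ha, t, rfl⟩ := (IsLocalization.mem_span_iff (nonZeroDivisors 𝒪[F])).1 hb
  refine ⟨t, nonZeroDivisors.coe_ne_zero t, ?_⟩
  rw [← algebraMap_smul F, smul_smul, IsLocalization.mk'_spec', map_one, one_smul]
  exact (Submodule.span_eq (Subalgebra.toSubmodule A)).le ha

lemma IsHereditaryOrder.exists_eq_rightMul (hA : IsHereditaryOrder F A)
    {L : Submodule A (Fin m → D)} (f : L →ₗ[A] (Fin m → D)) :
    ∃ d : D, ∀ w : L, f w = rightMul A d w := by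
  by_cases hL : ∀ w : L, w = 0
  · exact ⟨0, fun w => by rw [hL w]; simp⟩
  push Not at hL
  obtain ⟨w₀, hw₀⟩ := hL
  obtain ⟨i₀, hi₀⟩ : ∃ i, (w₀ : Fin m → D) i ≠ 0 :=
    Function.ne_iff.1 (by simpa using hw₀ : (w₀ : Fin m → D) ≠ 0)
  let u : Fin m → D := Pi.single i₀ ((w₀ : Fin m → D) i₀)⁻¹
  have huw₀ : u ⬝ᵥ (w₀ : Fin m → D) = 1 := by
    rw [single_dotProduct, inv_mul_cancel₀ hi₀]
  refine ⟨u ⬝ᵥ f w₀, fun w => ?_⟩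
  obtain ⟨t, ht, hmem⟩ := hA.exists_smul_mem (Matrix.vecMulVec (w : Fin m → D) u)
  rw [← Matrix.smul_vecMulVec] at hmem
  have hw : t • w = (⟨_, hmem⟩ : A) • w₀ := Subtype.ext <| by
    change t • (w : Fin m → D) = (⟨_, hmem⟩ : A) • (w₀ : Fin m → D)
    rw [vecMulVec_smul, huw₀, rightMul_one]
  refine smul_right_injective (Fin m → D) ht ?_
  change t • f w = t • rightMul A _ (w : Fin m → D)
  rw [← LinearMap.map_smul_of_tower, ← rightMul_smul, hw, map_smul, vecMulVec_smul]

variable [TopologicalSpace F] [IsNonarchimedeanLocalField F] [FiniteDimensional F D]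

lemma IsHereditaryOrder.exists_forall_mem_ball (hA : IsHereditaryOrder F A) :
    ∃ K : ℕ, ∀ a ∈ A, ∀ i j, a i j ∈ ball F (-K : ℝ) := by
  obtain ⟨S, hS⟩ := hA.fg
  obtain ⟨k, hk⟩ := InnerFormSL.exists_forall_mem_ball (F := F) fun p : S × Fin m × Fin m =>
    (p.1 : Matrix (Fin m) (Fin m) D) p.2.1 p.2.2
  have hk' : (-((-k).toNat : ℝ)) ≤ k := by
    have : -((-k).toNat : ℤ) ≤ k := by omega
    exact_mod_cast this
  refine ⟨(-k).toNat, fun a ha => ?_⟩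
  have ha' : a ∈ Submodule.span 𝒪[F] (S : Set (Matrix (Fin m) (Fin m) D)) := hS ▸ ha
  clear ha
  induction ha' using Submodule.span_induction with
  | mem a h => exact fun i j => ball_antitone hk' (hk (⟨a, h⟩, i, j))
  | zero => exact fun _ _ => zero_mem _
  | add a b _ _ iha ihb => exact fun i j => add_mem (iha i j) (ihb i j)
  | smul t a _ iha => exact fun i j => integer_smul_mem_ball (iha i j)

lemma IsHereditaryOrder.exists_forall_mem_of_forall_mem_ball (hA : IsHereditaryOrder F A) :
    ∃ k : ℤ, ∀ b : Matrix (Fin m) (Fin m) D, (∀ i j, b i j ∈ ball F k) → b ∈ A := by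
  let β := Module.finBasis F D
  obtain ⟨C, hC⟩ := exists_forall_repr_mem_ballF F β
  choose t ht hmem using fun p : Fin m × Fin m × Fin (Module.finrank F D) =>
    hA.exists_smul_mem (Matrix.single p.1 p.2.1 (β p.2.2))
  obtain ⟨N, hN⟩ := (Set.finite_range fun p => ordF F (t p : F)).bddAbove
  refine ⟨N + C, fun b hb => ?_⟩
  rw [Matrix.matrix_eq_sum_single b]
  refine sum_mem fun i _ => sum_mem fun j _ => ?_
  rw [← β.sum_repr (b i j), ← Matrix.singleAddMonoidHom_apply, map_sum]
  refine sum_mem fun l _ => ?_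
  have ht0 : (t (i, j, l) : F) ≠ 0 := Subtype.coe_ne_coe.2 (ht (i, j, l))
  have hcoeff : (t (i, j, l) : F)⁻¹ * β.repr (b i j) l ∈ 𝒪[F] := by
    have hrepr := hC (N + C) _ (hb i j) l
    rw [add_sub_cancel_right] at hrepr
    have hle : ordF F (t (i, j, l) : F) ≤ N := hN ⟨(i, j, l), rfl⟩
    refine mem_ballF_zero.1 (ballF_antitone ?_
      (mul_mem_ballF (mem_ballF.2 (.inr (ordF_inv (t (i, j, l) : F)).ge)) hrepr))
    omega
  have hsingle : Matrix.single i j (β.repr (b i j) l • β l) =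
      (⟨_, hcoeff⟩ : 𝒪[F]) • t (i, j, l) • Matrix.single i j (β l) := by
    rw [Subring.smul_def, Subring.smul_def, smul_smul, ← Matrix.smul_single]
    congr 1
    field_simp
  rw [Matrix.singleAddMonoidHom_apply, hsingle]
  exact A.smul_mem (hmem (i, j, l)) _

/-- A submodule of the column space whose elements have entries of valuation bounded below; the
nonzero ones are the lattices which are stable under `A`. -/
def IsBoundedSubmodule (N : Submodule A (Fin m → D)) : Prop :=
  ∃ k : ℤ, ∀ w ∈ N, ∀ i, w i ∈ ball F k

/-- A row vector concentrated in one coordinate embeds a lattice as a left ideal. -/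
lemma IsHereditaryOrder.projective_of_isBoundedSubmodule (hA : IsHereditaryOrder F A)
    (hm : 0 < m) {N : Submodule A (Fin m → D)} (hN : IsBoundedSubmodule N) :
    Module.Projective A N := by
  obtain ⟨k, hk⟩ := hN
  obtain ⟨l, hl⟩ := hA.exists_forall_mem_of_forall_mem_ball
  obtain ⟨t, ht, htk⟩ := exists_ordF_eq F (l - k)
  have htD : algebraMap F D t ≠ 0 := by simpa using ht
  let u : Fin m → D := Pi.single ⟨0, hm⟩ (algebraMap F D t)
  have hu : ∀ j, u j ∈ ball F ((l : ℝ) - k) := fun j => by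
    rcases eq_or_ne j ⟨0, hm⟩ with rfl | hj
    · rw [show u ⟨0, hm⟩ = algebraMap F D t from Pi.single_eq_same _ _, mem_ball_of_ne_zero htD,
        valD_algebraMap, htk, Int.cast_sub]
    · exact .inl (Pi.single_eq_of_ne hj _)
  have hmem : ∀ w ∈ N, Matrix.vecMulVec w u ∈ A := fun w hw => hl _ fun i j => by
    simpa only [Matrix.vecMulVec_apply, add_sub_cancel] using mul_mem_ball (hk w hw i) (hu j)
  have hinj : Function.Injective (vecMulVecMap hmem) := fun w w' h => by
    refine Subtype.ext (funext fun i => mul_right_cancel₀ htD ?_)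
    simpa [vecMulVecMap, Matrix.vecMulVec_apply, u] using
      congrFun (congrFun (congrArg Subtype.val h) i) ⟨0, hm⟩
  have := hA.projective (vecMulVecMap hmem).range
  exact Module.Projective.of_equiv (LinearEquiv.ofInjective _ hinj).symm

lemma valD_nonpos_of_add_eq_one {d d' : D} (h : d + d' = 1) :
    (d ≠ 0 ∧ valD F d ≤ 0) ∨ (d' ≠ 0 ∧ valD F d' ≤ 0) := by
  by_contra! hpos
  have hball : ∀ c : D, (c ≠ 0 → 0 < valD F c) → ∃ s, 0 < s ∧ c ∈ ball F s := fun c hc => by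
    rcases eq_or_ne c 0 with rfl | h0
    · exact ⟨1, one_pos, zero_mem _⟩
    · exact ⟨valD F c, hc h0, .inr le_rfl⟩
  obtain ⟨s, hs, hds⟩ := hball d hpos.1
  obtain ⟨s', hs', hds'⟩ := hball d' hpos.2
  have hone := add_mem (ball_antitone (min_le_left s s') hds)
    (ball_antitone (min_le_right s s') hds')
  rw [h, mem_ball_of_ne_zero one_ne_zero, valD_one] at hone
  exact hone.not_gt (lt_min hs hs')

lemma eq_top_of_forall_rightMul_mem {L : Submodule A (Fin m → D)}
    (hstab : ∀ d ∈ ball F (D := D) 0, ∀ w ∈ L, rightMul A d w ∈ L) {N : Submodule A L} {d : D}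
    (hd : d ≠ 0) (hdv : valD F d ≤ 0) (hN : ∀ w : L, ∃ n ∈ N, (n : Fin m → D) = rightMul A d w) :
    N = ⊤ := by
  refine eq_top_iff.2 fun w _ => ?_
  have hmem := hstab d⁻¹ (.inr (by rw [valD_inv hd]; linarith)) w w.2
  obtain ⟨n, hn, hnw⟩ := hN ⟨_, hmem⟩
  rw [rightMul_rightMul, inv_mul_cancel₀ hd, rightMul_one] at hnw
  rwa [← Subtype.ext hnw]

/-- A section of `N × N' → L` is a pair of right multiplications by elements with sum `1`, one of
which has valuation `≤ 0`. -/
lemma IsHereditaryOrder.eq_top_or_eq_top (hA : IsHereditaryOrder F A)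
    {L : Submodule A (Fin m → D)} (hL : Module.Projective A L)
    (hstab : ∀ d ∈ ball F (D := D) 0, ∀ w ∈ L, rightMul A d w ∈ L) (N N' : Submodule A L)
    (hNN : N ⊔ N' = ⊤) : N = ⊤ ∨ N' = ⊤ := by
  rcases subsingleton_or_nontrivial L with hsub | hnon
  · exact .inl (Subsingleton.elim _ _)
  obtain ⟨w₀, hw₀⟩ := exists_ne (0 : L)
  let p : N × N' →ₗ[A] L := LinearMap.coprod N.subtype N'.subtype
  have hp : LinearMap.range p = ⊤ := by
    rw [LinearMap.range_coprod, Submodule.range_subtype, Submodule.range_subtype, hNN]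
  obtain ⟨σ, hσ⟩ := p.exists_rightInverse_of_surjective hp
  obtain ⟨d, hd⟩ := hA.exists_eq_rightMul
    (L.subtype ∘ₗ N.subtype ∘ₗ LinearMap.fst A N N' ∘ₗ σ)
  obtain ⟨d', hd'⟩ := hA.exists_eq_rightMul
    (L.subtype ∘ₗ N'.subtype ∘ₗ LinearMap.snd A N N' ∘ₗ σ)
  have hdd : d + d' = 1 := by
    obtain ⟨i, hi⟩ := Function.ne_iff.1 (by simpa using hw₀ : (w₀ : Fin m → D) ≠ 0)
    have hsum : rightMul A d (w₀ : Fin m → D) + rightMul A d' (w₀ : Fin m → D) = w₀ := by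
      rw [← hd, ← hd']
      exact congrArg Subtype.val (LinearMap.congr_fun hσ w₀)
    refine mul_left_cancel₀ hi ?_
    rw [mul_add, mul_one]
    exact congrFun hsum i
  rcases valD_nonpos_of_add_eq_one (F := F) hdd with h | h
  · exact .inl (eq_top_of_forall_rightMul_mem hstab h.1 h.2 fun w => ⟨_, (σ w).1.2, hd w⟩)
  · exact .inr (eq_top_of_forall_rightMul_mem hstab h.1 h.2 fun w => ⟨_, (σ w).2.2, hd' w⟩)

end HereditaryOrder

section Generic

lemma finite_quotient_of_map_mem {R B : Type*} [CommRing R] [Ring B] [Algebra R B]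
    [Module.Finite R B] {I : Ideal R} [Finite (R ⧸ I)] {J : Ideal B} [J.IsTwoSided]
    (h : ∀ t ∈ I, algebraMap R B t ∈ J) : Finite (B ⧸ J) := by
  have htors : Module.IsTorsionBySet R (B ⧸ J) (I : Set R) := by
    rintro a ⟨t, ht⟩
    obtain ⟨a, rfl⟩ := Submodule.mkQ_surjective _ a
    change t • (Submodule.mkQ J).restrictScalars R a = 0
    rw [← map_smul]
    refine (Submodule.Quotient.mk_eq_zero _).2 ?_
    rw [Algebra.smul_def]
    exact J.mul_mem_right _ (h t ht)
  let _ := htors.module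
  have := htors.isScalarTower (S := R)
  have : Module.Finite (R ⧸ I) (B ⧸ J) := Module.Finite.of_restrictScalars_finite R _ _
  exact Module.finite_of_finite (R ⧸ I)

lemma pow_add_smul {R M : Type*} [Ring R] [AddCommGroup M] [Module R M] (J : Ideal R)
    [J.IsTwoSided] (k l : ℕ) (N : Submodule R M) : J ^ (k + l) • N = J ^ k • J ^ l • N := by
  rw [Ideal.IsTwoSided.pow_add, Submodule.mul_smul]

lemma map_rightMul_comm {R D n : Type*} [CommRing R] [Ring D] [Algebra R D] [Fintype n]
    [DecidableEq n] {A : Subalgebra R (Matrix n n D)} {d d' : D} (h : d * d' = d' * d)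
    (N : Submodule A (n → D)) :
    (N.map (rightMul A d)).map (rightMul A d') = (N.map (rightMul A d')).map (rightMul A d) := by
  rw [map_rightMul_map_rightMul, map_rightMul_map_rightMul, h]

end Generic

section Uniformizer

variable {F : Type*} [Field F] [ValuativeRel F] [TopologicalSpace F]
  [IsNonarchimedeanLocalField F] {ϖ : F}

lemma ne_zero_of_ordF_eq_one (hϖ : ordF F ϖ = 1) : ϖ ≠ 0 := by
  rintro rfl
  simp [ordF] at hϖ

lemma mem_integer_of_ordF_eq_one (hϖ : ordF F ϖ = 1) : ϖ ∈ 𝒪[F] :=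
  mem_ballF_zero.1 (mem_ballF.2 (.inr (by omega)))

lemma maximalIdeal_eq_span (hϖ : ordF F ϖ = 1) :
    𝓂[F] = Ideal.span {(⟨ϖ, mem_integer_of_ordF_eq_one hϖ⟩ : 𝒪[F])} := by
  ext t
  rw [Ideal.mem_span_singleton']
  constructor
  · intro ht
    have hdiv := mul_mem_ballF (mem_maximalIdeal_iff.1 ht) (mem_ballF.2 (.inr (ordF_inv ϖ).ge))
    rw [hϖ, add_neg_cancel, mem_ballF_zero] at hdiv
    exact ⟨⟨_, hdiv⟩, Subtype.ext (inv_mul_cancel_right₀ (ne_zero_of_ordF_eq_one hϖ) _)⟩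
  · rintro ⟨c, rfl⟩
    exact Ideal.mul_mem_left _ _ (mem_maximalIdeal_iff.2 (mem_ballF.2 (.inr hϖ.ge)))

variable {D : Type*} [DivisionRing D] [Algebra F D]

lemma algebraMap_ne_zero_of_ordF_eq_one (hϖ : ordF F ϖ = 1) : algebraMap F D ϖ ≠ 0 :=
  (map_ne_zero _).2 (ne_zero_of_ordF_eq_one hϖ)

lemma valD_algebraMap_zpow [FiniteDimensional F D] (hϖ : ordF F ϖ = 1) (z : ℤ) :
    valD F (algebraMap F D ϖ ^ z) = z := by
  rw [← map_zpow₀, valD_algebraMap, ordF_zpow, hϖ, mul_one]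

end Uniformizer

section RamificationIndex

variable {F : Type*} [Field F] [ValuativeRel F] [TopologicalSpace F]
  [IsNonarchimedeanLocalField F]
variable {D : Type*} [DivisionRing D] [Algebra F D] {m : ℕ}
variable {A : Subalgebra 𝒪[F] (Matrix (Fin m) (Fin m) D)} {e : ℕ} {ϖ : F}

lemma IsRamificationIndex.mem_jacobson_pow_iff (he : IsRamificationIndex F A e)
    (hϖ : ordF F ϖ = 1) {a : A} : a ∈ Ring.jacobson A ^ e ↔
      ∃ b : A, b * algebraMap 𝒪[F] A ⟨ϖ, mem_integer_of_ordF_eq_one hϖ⟩ = a := by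
  rw [← he, maximalIdeal_eq_span hϖ, Ideal.map_span, Set.image_singleton,
    Ideal.mem_span_singleton']

lemma IsRamificationIndex.jacobson_pow_smul (he : IsRamificationIndex F A e)
    (hϖ : ordF F ϖ = 1) (N : Submodule A (Fin m → D)) :
    Ring.jacobson A ^ e • N = N.map (rightMul A (algebraMap F D ϖ)) := by
  have hsmul : ∀ w : Fin m → D, algebraMap 𝒪[F] A ⟨ϖ, mem_integer_of_ordF_eq_one hϖ⟩ • w =
      rightMul A (algebraMap F D ϖ) w := fun w => by
    ext i
    rw [algebraMap_smul, rightMul_apply, ← Algebra.commutes, ← Algebra.smul_def]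
    rfl
  apply le_antisymm
  · rw [Submodule.smul_le]
    intro a ha w hw
    obtain ⟨b, rfl⟩ := (he.mem_jacobson_pow_iff hϖ).1 ha
    rw [mul_smul, hsmul, ← map_smul]
    exact Submodule.mem_map_of_mem (N.smul_mem b hw)
  · rintro _ ⟨w, hw, rfl⟩
    rw [← hsmul]
    exact Submodule.smul_mem_smul ((he.mem_jacobson_pow_iff hϖ).2 ⟨1, one_mul _⟩) hw

lemma IsRamificationIndex.jacobson_pow_mul_smul (he : IsRamificationIndex F A e)
    (hϖ : ordF F ϖ = 1) (N : Submodule A (Fin m → D)) (k : ℕ) :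
    Ring.jacobson A ^ (e * k) • N = N.map (rightMul A (algebraMap F D ϖ ^ k)) := by
  induction k with
  | zero =>
    rw [mul_zero, pow_zero, map_rightMul_one, Submodule.pow_zero, Ideal.one_eq_top,
      Submodule.top_smul]
  | succ k ih =>
    rw [mul_add_one, add_comm, pow_add_smul, ih, he.jacobson_pow_smul hϖ,
      map_rightMul_map_rightMul, pow_succ]

lemma IsRamificationIndex.pos (he : IsRamificationIndex F A e) (hA : IsHereditaryOrder F A)
    (hm : 0 < m) : 0 < e := by
  by_contra! h0
  obtain rfl : e = 0 := by omega
  have : NeZero m := ⟨hm.ne'⟩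
  obtain ⟨ϖ, -, hϖ⟩ := exists_ordF_eq F 1
  have hmaxsmul : (⊤ : Submodule 𝒪[F] A) ≤ 𝓂[F] • ⊤ := fun a _ => by
    have ha : a ∈ Ring.jacobson A ^ 0 := by
      rw [Submodule.pow_zero, Ideal.one_eq_top]
      exact Submodule.mem_top
    obtain ⟨b, rfl⟩ := (he.mem_jacobson_pow_iff hϖ).1 ha
    rw [← Algebra.commutes, ← Algebra.smul_def]
    exact Submodule.smul_mem_smul (mem_maximalIdeal_iff.2 (mem_ballF.2 (.inr hϖ.ge)))
      Submodule.mem_top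
  have hbot := Submodule.eq_bot_of_le_smul_of_le_jacobson_bot _ _
    ((Submodule.fg_top _).2 hA.fg) hmaxsmul (IsLocalRing.maximalIdeal_le_jacobson _)
  exact one_ne_zero ((Submodule.mem_bot 𝒪[F]).1 (hbot ▸ Submodule.mem_top : (1 : A) ∈ _))

lemma IsHereditaryOrder.isSemisimpleRing_quotient (hA : IsHereditaryOrder F A)
    (he : IsRamificationIndex F A e) (hpos : 0 < e) : IsSemisimpleRing (A ⧸ Ring.jacobson A) := by
  have : Module.Finite 𝒪[F] A := ⟨(Submodule.fg_top _).2 hA.fg⟩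
  have : Finite (𝒪[F] ⧸ 𝓂[F]) := inferInstanceAs (Finite 𝓀[F])
  have : Finite (A ⧸ Ring.jacobson A) := finite_quotient_of_map_mem fun t (ht : t ∈ 𝓂[F]) =>
    Ideal.pow_le_self hpos.ne' (he ▸ Ideal.mem_map_of_mem _ ht)
  exact IsArtinianRing.isSemisimpleRing_iff_jacobson.2 (Ring.jacobson_quotient_jacobson A)

end RamificationIndex

section Chain

variable {F : Type*} [Field F] [ValuativeRel F] [TopologicalSpace F]
  [IsNonarchimedeanLocalField F]
variable {D : Type*} [DivisionRing D] [Algebra F D] [FiniteDimensional F D] {m : ℕ}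
variable {A : Subalgebra 𝒪[F] (Matrix (Fin m) (Fin m) D)} {e : ℕ} {ϖ : F}

variable (A) in
/-- The lattice `A 𝔬_D^m` in the column space. -/
def baseLattice : Submodule A (Fin m → D) := Submodule.span A {w | ∀ i, w i ∈ ball F 0}

lemma map_rightMul_baseLattice_le {d : D} (hd : d ∈ ball F (D := D) 0) :
    (baseLattice A).map (rightMul A d) ≤ baseLattice A := by
  rw [baseLattice, Submodule.map_span, Submodule.span_le]
  rintro _ ⟨w, hw, rfl⟩
  exact Submodule.subset_span fun i => by
    simpa only [rightMul_apply, add_zero] using mul_mem_ball (hw i) hd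

lemma mem_ball_of_mem_baseLattice {K : ℕ} (hK : ∀ a ∈ A, ∀ i j, a i j ∈ ball F (-K : ℝ))
    {w : Fin m → D} (hw : w ∈ baseLattice A) (i : Fin m) : w i ∈ ball F (-K : ℝ) := by
  suffices H : ∀ a : A, ∀ i, (a • w) i ∈ ball F (-K : ℝ) by simpa only [one_smul] using H 1 i
  induction hw using Submodule.span_induction with
  | mem w h =>
    refine fun a i => AddSubgroup.sum_mem _ fun j _ => ?_
    simpa only [add_zero, smul_eq_mul] using mul_mem_ball (hK a a.2 i j) (h j)
  | zero => exact fun a i => by rw [smul_zero]; exact zero_mem _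
  | add w u _ _ hw hu => exact fun a i => by rw [smul_add]; exact add_mem (hw a i) (hu a i)
  | smul b w _ hw => exact fun a i => by rw [smul_smul]; exact hw _ i

variable (A e ϖ) in
/-- The chain `J^k A 𝔬_D^m ϖ^q` (`0 ≤ k < e`, `q ∈ ℤ`, in the order of `k + q e`) of lattices in the
column space, where `J` is the Jacobson radical of `A`. If `A` is hereditary, `ϖ` is a uniformizer
of `F` and `e` is the ramification index, it consists of all `A`-lattices. -/
def chain (n : ℤ) : Submodule A (Fin m → D) :=
  (Ring.jacobson A ^ (n % e).toNat • baseLattice A).map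
    (rightMul A (algebraMap F D ϖ ^ (n / e)))

lemma chain_natCast_add_mul (he : IsRamificationIndex F A e) (hpos : 0 < e)
    (hϖ : ordF F ϖ = 1) (k : ℕ) (q : ℤ) : chain A e ϖ (k + q * e) =
      (Ring.jacobson A ^ k • baseLattice A).map (rightMul A (algebraMap F D ϖ ^ q)) := by
  have hne : (e : ℤ) ≠ 0 := by omega
  conv_rhs => rw [← Nat.mod_add_div k e, pow_add_smul, he.jacobson_pow_mul_smul hϖ,
    ← Submodule.map_smul'', map_rightMul_map_rightMul, ← zpow_natCast,
    ← zpow_add₀ (algebraMap_ne_zero_of_ordF_eq_one hϖ)]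
  rw [chain, Int.add_mul_emod_self_right, Int.add_mul_ediv_right _ _ hne, ← Int.natCast_mod,
    Int.toNat_natCast, ← Int.natCast_div]

lemma exists_eq_natCast_add_mul (hpos : 0 < e) (n : ℤ) : ∃ (k : ℕ) (q : ℤ), n = k + q * e :=
  ⟨(n % e).toNat, n / e, by
    rw [Int.toNat_of_nonneg (Int.emod_nonneg n (by omega)), mul_comm, Int.emod_add_mul_ediv]⟩

lemma chain_zero : chain A e ϖ 0 = baseLattice A := by
  rw [chain, Int.zero_emod, Int.zero_ediv, Int.toNat_zero, zpow_zero, map_rightMul_one,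
    Submodule.pow_zero, Ideal.one_eq_top, Submodule.top_smul]

lemma chain_add_mul (hpos : 0 < e) (hϖ : ordF F ϖ = 1) (n k : ℤ) :
    chain A e ϖ (n + k * e) = (chain A e ϖ n).map (rightMul A (algebraMap F D ϖ ^ k)) := by
  have hne : (e : ℤ) ≠ 0 := by omega
  rw [chain, chain, map_rightMul_map_rightMul,
    ← zpow_add₀ (algebraMap_ne_zero_of_ordF_eq_one hϖ), Int.add_mul_emod_self_right,
    Int.add_mul_ediv_right _ _ hne]

lemma jacobson_pow_smul_chain (he : IsRamificationIndex F A e) (hpos : 0 < e)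
    (hϖ : ordF F ϖ = 1) (n : ℤ) (k : ℕ) :
    Ring.jacobson A ^ k • chain A e ϖ n = chain A e ϖ (n + k) := by
  obtain ⟨l, q, rfl⟩ := exists_eq_natCast_add_mul hpos n
  rw [add_right_comm, ← Nat.cast_add, chain_natCast_add_mul he hpos hϖ,
    chain_natCast_add_mul he hpos hϖ, ← Submodule.map_smul'', ← pow_add_smul, add_comm]

lemma chain_antitone (he : IsRamificationIndex F A e) (hpos : 0 < e)
    (hϖ : ordF F ϖ = 1) : Antitone (chain A e ϖ) := fun n n' h => by
  obtain ⟨k, rfl⟩ := Int.le.dest h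
  rw [← jacobson_pow_smul_chain he hpos hϖ]
  exact Submodule.smul_le_right

lemma map_rightMul_chain_le {d : D} (hd : d ∈ ball F (D := D) 0) (n : ℤ) :
    (chain A e ϖ n).map (rightMul A d) ≤ chain A e ϖ n := by
  rw [chain, map_rightMul_comm (by rw [← map_zpow₀, Algebra.commutes]), Submodule.map_smul'']
  exact Submodule.map_mono (Submodule.smul_mono le_rfl (map_rightMul_baseLattice_le hd))

lemma mem_ball_of_mem_chain (hpos : 0 < e) (hϖ : ordF F ϖ = 1) {K : ℕ}
    (hK : ∀ a ∈ A, ∀ i j, a i j ∈ ball F (-K : ℝ)) {n : ℤ} {w : Fin m → D}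
    (hw : w ∈ chain A e ϖ n) (i : Fin m) : w i ∈ ball F ((n : ℝ) / e - (K + 1)) := by
  obtain ⟨u, hu, rfl⟩ := hw
  have hui := mem_ball_of_mem_baseLattice hK (Submodule.smul_le_right hu) i
  rw [rightMul_apply]
  refine ball_antitone ?_ (mul_mem_ball hui (.inr (valD_algebraMap_zpow hϖ (n / e)).ge))
  have hdiv : (n : ℝ) < e * ((n / e : ℤ) + 1) := by
    exact_mod_cast Int.lt_mul_ediv_self_add (x := n) (by omega : (0 : ℤ) < e) |>.trans_eq (by ring)
  have := (div_lt_iff₀' (by exact_mod_cast hpos)).2 hdiv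
  linarith

lemma IsHereditaryOrder.isBoundedSubmodule_chain (hA : IsHereditaryOrder F A) (hpos : 0 < e)
    (hϖ : ordF F ϖ = 1) (n : ℤ) : IsBoundedSubmodule (chain A e ϖ n) := by
  obtain ⟨K, hK⟩ := hA.exists_forall_mem_ball
  exact ⟨⌊(n : ℝ) / e - (K + 1)⌋, fun w hw i => ball_antitone (Int.floor_le _)
    (mem_ball_of_mem_chain hpos hϖ hK hw i)⟩

lemma mem_chain_of_forall_mem_ball (hpos : 0 < e) (hϖ : ordF F ϖ = 1) {k : ℤ} {w : Fin m → D}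
    (hw : ∀ i, w i ∈ ball F (k : ℝ)) : w ∈ chain A e ϖ (k * e) := by
  rw [← zero_add (k * (e : ℤ)), chain_add_mul hpos hϖ, chain_zero]
  refine ⟨rightMul A (algebraMap F D ϖ ^ (-k)) w, Submodule.subset_span fun i => ?_, ?_⟩
  · have hmul := mul_mem_ball (hw i) (.inr (valD_algebraMap_zpow (D := D) hϖ (-k)).ge)
    rwa [Int.cast_neg, add_neg_cancel] at hmul
  · rw [rightMul_rightMul, ← zpow_add₀ (algebraMap_ne_zero_of_ordF_eq_one hϖ), neg_add_cancel,
      zpow_zero, rightMul_one]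

lemma exists_mem_chain (hpos : 0 < e) (hϖ : ordF F ϖ = 1) (w : Fin m → D) :
    ∃ n, w ∈ chain A e ϖ n :=
  (exists_forall_mem_ball (F := F) w).imp' (· * (e : ℤ)) fun _ =>
    mem_chain_of_forall_mem_ball hpos hϖ

lemma IsHereditaryOrder.exists_notMem_chain (hA : IsHereditaryOrder F A) (hpos : 0 < e)
    (hϖ : ordF F ϖ = 1) {w : Fin m → D} (hw : w ≠ 0) : ∃ n, w ∉ chain A e ϖ n := by
  obtain ⟨K, hK⟩ := hA.exists_forall_mem_ball
  obtain ⟨i, hi⟩ := Function.ne_iff.1 hw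
  refine ⟨(⌈valD F (w i)⌉ + K + 2) * e, fun h => ?_⟩
  have hball := mem_ball_of_mem_chain hpos hϖ hK h i
  have he' : (e : ℝ) ≠ 0 := by exact_mod_cast hpos.ne'
  rw [mem_ball_of_ne_zero hi] at hball
  push_cast at hball
  rw [mul_div_cancel_right₀ _ he'] at hball
  have := Int.le_ceil (valD F (w i))
  linarith

/-- Nakayama's lemma, since `chain n / J chain n` is a simple `A`-module. -/
lemma IsHereditaryOrder.le_chain_add_one (hA : IsHereditaryOrder F A) (hm : 0 < m)
    (he : IsRamificationIndex F A e) (hϖ : ordF F ϖ = 1) {n : ℤ}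
    {N : Submodule A (Fin m → D)} (hN : N < chain A e ϖ n) : N ≤ chain A e ϖ (n + 1) := by
  have hpos := he.pos hA hm
  have := hA.isSemisimpleRing_quotient he hpos
  have hne : N.comap (chain A e ϖ n).subtype ≠ ⊤ := fun h =>
    hN.not_ge (Submodule.comap_subtype_eq_top.1 h)
  have hproj := hA.projective_of_isBoundedSubmodule hm (hA.isBoundedSubmodule_chain hpos hϖ n)
  have hM := hA.eq_top_or_eq_top hproj fun d hd w hw => map_rightMul_chain_le hd n ⟨w, hw, rfl⟩
  intro w hw
  have hmem := le_jacobson_smul_top_of_ne_top hM hne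
    (show (⟨w, hN.le hw⟩ : chain A e ϖ n) ∈ _ from hw)
  rw [Submodule.mem_smul_top_iff, ← Submodule.pow_one (Ring.jacobson A),
    jacobson_pow_smul_chain he hpos hϖ] at hmem
  exact_mod_cast hmem

lemma IsHereditaryOrder.exists_eq_chain (hA : IsHereditaryOrder F A) (hm : 0 < m)
    (he : IsRamificationIndex F A e) (hϖ : ordF F ϖ = 1)
    {N : Submodule A (Fin m → D)} (hN : IsBoundedSubmodule N) (hne : N ≠ ⊥) :
    ∃ n, N = chain A e ϖ n := by
  have hpos := he.pos hA hm
  obtain ⟨k, hk⟩ := hN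
  obtain ⟨w, hw, hw0⟩ := Submodule.exists_mem_ne_zero_of_ne_bot hne
  obtain ⟨b, hb⟩ := hA.exists_notMem_chain hpos hϖ hw0
  obtain ⟨n, hn, hmax⟩ := Int.exists_greatest_of_bdd (P := fun n => N ≤ chain A e ϖ n)
    ⟨b, fun n hn => by
      by_contra! hlt
      exact hb (chain_antitone he hpos hϖ hlt.le (hn hw))⟩
    ⟨k * e, fun u hu => mem_chain_of_forall_mem_ball hpos hϖ (hk u hu)⟩
  refine ⟨n, by_contra fun h => ?_⟩
  have := hmax _ (hA.le_chain_add_one hm he hϖ (lt_of_le_of_ne hn h))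
  omega

lemma chain_ne_bot (hm : 0 < m) (he : IsRamificationIndex F A e) (hpos : 0 < e)
    (hϖ : ordF F ϖ = 1) (n : ℤ) : chain A e ϖ n ≠ ⊥ := by
  intro h
  have hmem : (fun _ => algebraMap F D ϖ ^ |n| : Fin m → D) ∈ chain A e ϖ (|n| * e) :=
    mem_chain_of_forall_mem_ball hpos hϖ fun _ => .inr (valD_algebraMap_zpow hϖ _).ge
  have hn : n ≤ |n| * e := (le_abs_self n).trans
    (le_mul_of_one_le_right (abs_nonneg n) (by exact_mod_cast hpos))
  have hzero := chain_antitone he hpos hϖ hn hmem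
  rw [h, Submodule.mem_bot] at hzero
  exact zpow_ne_zero _ (algebraMap_ne_zero_of_ordF_eq_one hϖ) (congrFun hzero ⟨0, hm⟩)

lemma IsHereditaryOrder.chain_strictAnti (hA : IsHereditaryOrder F A) (hm : 0 < m)
    (he : IsRamificationIndex F A e) (hϖ : ordF F ϖ = 1) : StrictAnti (chain A e ϖ) := by
  have hpos := he.pos hA hm
  have hanti := chain_antitone he hpos hϖ
  refine strictAnti_int_of_succ_lt fun n => lt_of_le_of_ne (hanti (by omega)) fun h => ?_
  have hconst : ∀ k : ℕ, chain A e ϖ (n + k) = chain A e ϖ n := fun k => by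
    induction k with
    | zero => rw [Nat.cast_zero, add_zero]
    | succ k ih =>
      rw [Nat.cast_succ, add_comm (k : ℤ), ← add_assoc, ← jacobson_pow_smul_chain he hpos hϖ, h,
        jacobson_pow_smul_chain he hpos hϖ, ih]
  obtain ⟨w, hw, hw0⟩ := Submodule.exists_mem_ne_zero_of_ne_bot (chain_ne_bot hm he hpos hϖ n)
  obtain ⟨l, hl⟩ := hA.exists_notMem_chain hpos hϖ hw0
  refine hl (hanti (show l ≤ n + (l - n).toNat by omega) ?_)
  rwa [hconst]

end Chain

section ChainShift

lemma rightMul_injective {R D n : Type*} [CommRing R] [DivisionRing D] [Algebra R D] [Fintype n]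
    [DecidableEq n] {A : Subalgebra R (Matrix n n D)} {d : D} (hd : d ≠ 0) :
    Function.Injective (rightMul A d) :=
  fun _ _ h => funext fun i => mul_right_cancel₀ hd (congrFun h i)

variable {F : Type*} [Field F] [ValuativeRel F] [TopologicalSpace F]
  [IsNonarchimedeanLocalField F]
variable {D : Type*} [DivisionRing D] [Algebra F D] [FiniteDimensional F D] {m : ℕ}
variable {A : Subalgebra 𝒪[F] (Matrix (Fin m) (Fin m) D)} {e : ℕ} {ϖ : F}

lemma map_rightMul_pow_chain {d : D} {c : ℤ}
    (h : ∀ n, (chain A e ϖ n).map (rightMul A d) = chain A e ϖ (n + c)) (k : ℕ) (n : ℤ) :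
    (chain A e ϖ n).map (rightMul A (d ^ k)) = chain A e ϖ (n + k * c) := by
  induction k with
  | zero => rw [pow_zero, map_rightMul_one, Nat.cast_zero, zero_mul, add_zero]
  | succ k ih =>
    rw [pow_succ, ← map_rightMul_map_rightMul, ih, h]
    congr 1
    push_cast
    ring

lemma map_rightMul_chain_of_valD_eq_zero {u : D} (hu : u ≠ 0) (hv : valD F u = 0) (n : ℤ) :
    (chain A e ϖ n).map (rightMul A u) = chain A e ϖ n := by
  refine le_antisymm (map_rightMul_chain_le (.inr hv.ge) n) ?_
  have hinv : valD F u⁻¹ = 0 := by rw [valD_inv hu, hv, neg_zero]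
  have hle := Submodule.map_mono (f := rightMul A u)
    (map_rightMul_chain_le (A := A) (e := e) (ϖ := ϖ) (.inr hinv.ge) n)
  rwa [map_rightMul_map_rightMul, inv_mul_cancel₀ hu, map_rightMul_one] at hle

lemma IsHereditaryOrder.exists_map_rightMul_chain (hA : IsHereditaryOrder F A) (hm : 0 < m)
    (he : IsRamificationIndex F A e) (hϖ : ordF F ϖ = 1) {d : D} (hd : d ≠ 0) :
    ∃ c : ℤ, ∀ n, (chain A e ϖ n).map (rightMul A d) = chain A e ϖ (n + c) := by
  have hpos := he.pos hA hm
  have hbounded : IsBoundedSubmodule ((chain A e ϖ 0).map (rightMul A d)) := by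
    obtain ⟨k, hk⟩ := hA.isBoundedSubmodule_chain hpos hϖ 0
    refine ⟨⌊k + valD F d⌋, ?_⟩
    rintro _ ⟨w, hw, rfl⟩ i
    exact ball_antitone (Int.floor_le _) (mul_mem_ball (hk w hw i) (.inr le_rfl))
  have hne : (chain A e ϖ 0).map (rightMul A d) ≠ ⊥ := fun h =>
    chain_ne_bot hm he hpos hϖ 0 <| Submodule.map_injective_of_injective (rightMul_injective hd) <|
      h.trans (Submodule.map_bot _).symm
  obtain ⟨c, hc⟩ := hA.exists_eq_chain hm he hϖ hbounded hne
  refine ⟨c, fun n => ?_⟩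
  obtain ⟨k, q, rfl⟩ := exists_eq_natCast_add_mul hpos n
  rw [chain_natCast_add_mul he hpos hϖ, ← chain_zero (e := e) (ϖ := ϖ),
    map_rightMul_comm (by rw [← map_zpow₀, Algebra.commutes]), Submodule.map_smul'', hc,
    jacobson_pow_smul_chain he hpos hϖ, ← chain_add_mul hpos hϖ]
  congr 1
  ring

lemma IsHereditaryOrder.map_rightMul_chain (hA : IsHereditaryOrder F A) (hm : 0 < m)
    (he : IsRamificationIndex F A e) (hϖ : ordF F ϖ = 1) {d : D} (hd : d ≠ 0) :
    ∃ c : ℤ, (c : ℝ) = e * valD F d ∧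
      ∀ n, (chain A e ϖ n).map (rightMul A d) = chain A e ϖ (n + c) := by
  have hpos := he.pos hA hm
  obtain ⟨c, hc⟩ := hA.exists_map_rightMul_chain hm he hϖ hd
  obtain ⟨q, _, hq⟩ := exists_isUniformizer F D
  obtain ⟨k, hk⟩ := hq.exists_valD_eq d hd
  have hq0 : (q : ℝ) ≠ 0 := mod_cast hq.pos.ne'
  have hϖ0 : algebraMap F D ϖ ≠ 0 := algebraMap_ne_zero_of_ordF_eq_one hϖ
  set u := d ^ q * algebraMap F D ϖ ^ (-k) with hu
  have hu0 : u ≠ 0 := mul_ne_zero (pow_ne_zero _ hd) (zpow_ne_zero _ hϖ0)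
  have hvu : valD F u = 0 := by
    rw [hu, valD_mul (pow_ne_zero _ hd) (zpow_ne_zero _ hϖ0), valD_pow, valD_algebraMap_zpow hϖ,
      hk, mul_div_cancel₀ _ hq0, Int.cast_neg, add_neg_cancel]
  have hshift : chain A e ϖ (0 + q * c + -k * e) = chain A e ϖ 0 := by
    rw [chain_add_mul hpos hϖ, ← map_rightMul_pow_chain hc, map_rightMul_map_rightMul,
      map_rightMul_chain_of_valD_eq_zero hu0 hvu]
  have hqc : (q : ℝ) * c = k * e := by
    have := (hA.chain_strictAnti hm he hϖ).injective hshift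
    exact_mod_cast (by linarith : (q : ℤ) * c = k * e)
  refine ⟨c, ?_, hc⟩
  rw [hk, mul_div_assoc', eq_div_iff hq0, mul_comm, hqc, mul_comm]

end ChainShift

section RadicalOfShift

lemma exists_mem_jacobson_pow_of_mem_smul {R W : Type*} [Ring R] [AddCommGroup W] [Module R W]
    {M : Submodule R R} {N : Submodule R W} (σ : N →ₗ[R] M) {k : ℕ} {x : W}
    (hx : x ∈ Ring.jacobson R ^ k • N) :
    ∃ hx : x ∈ N, (σ ⟨x, hx⟩ : R) ∈ Ring.jacobson R ^ k := by
  induction hx using Submodule.smul_induction_on' with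
  | smul r hr y hy =>
    refine ⟨N.smul_mem r hy, ?_⟩
    change (σ (r • ⟨y, hy⟩) : R) ∈ _
    rw [map_smul]
    exact Ideal.mul_mem_right _ _ hr
  | add x _ y _ hx hy =>
    obtain ⟨hxN, hx⟩ := hx
    obtain ⟨hyN, hy⟩ := hy
    refine ⟨N.add_mem hxN hyN, ?_⟩
    change (σ (⟨x, hxN⟩ + ⟨y, hyN⟩) : R) ∈ _
    rw [map_add]
    exact add_mem hx hy

variable {F : Type*} [Field F] [ValuativeRel F]
variable {D : Type*} [DivisionRing D] [Algebra F D] {m : ℕ}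
variable {A : Subalgebra 𝒪[F] (Matrix (Fin m) (Fin m) D)} {e : ℕ} {ϖ : F}
  {b : Matrix (Fin m) (Fin m) D} {k : ℕ}

/-- An `A`-linear map `σ` commutes with `b`, although `b` need not lie in `A`, because a nonzero
scalar multiple of `b` does. -/
lemma IsHereditaryOrder.exists_eq_mul_of_smul_mem (hA : IsHereditaryOrder F A)
    {M : Submodule A A} {N : Submodule A (Fin m → D)} (σ : N →ₗ[A] M) (w : N)
    (h : b • (w : Fin m → D) ∈ Ring.jacobson A ^ k • N) :
    ∃ a ∈ Ring.jacobson A ^ k, (a : Matrix (Fin m) (Fin m) D) = b * (σ w : A) := by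
  obtain ⟨hbw, hmem⟩ := exists_mem_jacobson_pow_of_mem_smul σ h
  refine ⟨_, hmem, ?_⟩
  obtain ⟨t, ht, htb⟩ := hA.exists_smul_mem b
  have hscalar : t • (⟨b • (w : Fin m → D), hbw⟩ : N) = (⟨t • b, htb⟩ : A) • w :=
    Subtype.ext (smul_assoc t b (w : Fin m → D)).symm
  have hσ := congrArg (fun x => ((σ x : A) : Matrix (Fin m) (Fin m) D)) hscalar
  simp only [LinearMap.map_smul_of_tower, map_smul] at hσ
  have ht' : (t : F) ≠ 0 := fun h => ht (Subtype.ext h)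
  refine smul_right_injective (Matrix (Fin m) (Fin m) D) ht' ?_
  change (t : F) • ((σ ⟨b • (w : Fin m → D), hbw⟩ : A) : Matrix (Fin m) (Fin m) D) = t • b * _ at hσ
  rw [smul_mul_assoc] at hσ
  exact hσ

variable [TopologicalSpace F] [IsNonarchimedeanLocalField F] [FiniteDimensional F D]

lemma IsHereditaryOrder.isBoundedSubmodule_map_columnMap (hA : IsHereditaryOrder F A)
    (M : Submodule A A) (j : Fin m) : IsBoundedSubmodule (M.map (columnMap A j)) := by
  obtain ⟨K, hK⟩ := hA.exists_forall_mem_ball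
  refine ⟨-K, ?_⟩
  rintro _ ⟨c, _, rfl⟩ i
  exact_mod_cast hK c c.2 i j

lemma IsHereditaryOrder.exists_columnMap_eq_of_smul_mem_chain (hA : IsHereditaryOrder F A)
    (hm : 0 < m) (he : IsRamificationIndex F A e) (hϖ : ordF F ϖ = 1)
    (hb : ∀ n, ∀ w ∈ chain A e ϖ n, b • w ∈ chain A e ϖ (n + k)) (M : Submodule A A) (j : Fin m)
    {a : A} (ha : a ∈ M) :
    ∃ c ∈ M, columnMap A j c = columnMap A j a ∧
      ∃ a' ∈ Ring.jacobson A ^ k, (a' : Matrix (Fin m) (Fin m) D) = b * (c : A) := by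
  set N := M.map (columnMap A j)
  have hN : IsBoundedSubmodule N := hA.isBoundedSubmodule_map_columnMap M j
  have hproj := hA.projective_of_isBoundedSubmodule hm hN
  let f : M →ₗ[A] N := (columnMap A j).submoduleMap M
  obtain ⟨σ, hσ⟩ := f.exists_rightInverse_of_surjective
    (LinearMap.range_eq_top.2 ((columnMap A j).submoduleMap_surjective M))
  have hbN : ∀ w ∈ N, b • w ∈ Ring.jacobson A ^ k • N := fun w hw => by
    by_cases hbot : N = ⊥
    · have hw0 : w = 0 := (Submodule.mem_bot A).1 (hbot ▸ hw)
      rw [hw0, smul_zero]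
      exact zero_mem _
    · obtain ⟨n, hn⟩ := hA.exists_eq_chain hm he hϖ hN hbot
      rw [hn, jacobson_pow_smul_chain he (he.pos hA hm) hϖ]
      exact hb n w (hn ▸ hw)
  let w : N := f ⟨a, ha⟩
  exact ⟨σ w, (σ w).2, congrArg Subtype.val (LinearMap.congr_fun hσ w),
    hA.exists_eq_mul_of_smul_mem σ w (hbN w w.2)⟩

lemma IsHereditaryOrder.exists_mem_jacobson_pow_of_smul_mem_chain (hA : IsHereditaryOrder F A)
    (hm : 0 < m) (he : IsRamificationIndex F A e) (hϖ : ordF F ϖ = 1)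
    (hb : ∀ n, ∀ w ∈ chain A e ϖ n, b • w ∈ chain A e ϖ (n + k)) :
    ∃ a ∈ Ring.jacobson A ^ k, (a : Matrix (Fin m) (Fin m) D) = b := by
  suffices H : ∀ (S : Finset (Fin m)) (a : A), (∀ j ∉ S, columnMap A j a = 0) →
      ∃ a' ∈ Ring.jacobson A ^ k, (a' : Matrix (Fin m) (Fin m) D) = b * (a : A) by
    obtain ⟨a, ha, hab⟩ := H Finset.univ 1 fun j hj => absurd (Finset.mem_univ j) hj
    exact ⟨a, ha, hab.trans (mul_one b)⟩
  intro S
  induction S using Finset.induction_on with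
  | empty =>
    intro a ha
    have ha0 : (a : Matrix (Fin m) (Fin m) D) = 0 :=
      Matrix.ext fun i j => congrFun (ha j (Finset.notMem_empty j)) i
    exact ⟨0, zero_mem _, by rw [ha0, mul_zero, ZeroMemClass.coe_zero]⟩
  | insert j S _ ih =>
    intro a ha
    obtain ⟨c, hcM, hcj, a₁, ha₁, hba₁⟩ := hA.exists_columnMap_eq_of_smul_mem_chain hm he hϖ hb
      (⨅ l ∉ insert j S, (columnMap A l).ker) j
      (by simpa only [Submodule.mem_iInf, LinearMap.mem_ker] using ha)
    simp only [Submodule.mem_iInf, LinearMap.mem_ker] at hcM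
    obtain ⟨a₂, ha₂, hba₂⟩ := ih (a - c) fun l hl => by
      rw [map_sub, sub_eq_zero]
      by_cases hlj : l = j
      · rw [hlj, hcj]
      · have hl' : l ∉ insert j S := fun h => (Finset.mem_insert.1 h).elim hlj hl
        rw [ha l hl', hcM l hl']
    refine ⟨a₁ + a₂, add_mem ha₁ ha₂, ?_⟩
    rw [Subalgebra.coe_add, hba₁, hba₂, Subalgebra.coe_sub, mul_sub, add_sub_cancel]

end RadicalOfShift

section Splitting

lemma isUnit_of_forall_smul_eq_zero {D n : Type*} [DivisionRing D] [Fintype n] [DecidableEq n]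
    {g : Matrix n n D} (hg : ∀ u : n → D, g • u = 0 → u = 0) : IsUnit g := by
  refine IsArtinianRing.isUnit_iff_isLeftRegular.2 fun a b (hab : g * a = g * b) => ?_
  have hzero : g * (a - b) = 0 := by rw [mul_sub, hab, sub_self]
  refine sub_eq_zero.1 (Matrix.ext fun i j => ?_)
  exact congrFun (hg ((a - b).col j) (funext fun l => congrFun (congrFun hzero l) j)) i

variable {F : Type*} [Field F] [ValuativeRel F] [TopologicalSpace F]
  [IsNonarchimedeanLocalField F]
variable {D : Type*} [DivisionRing D] [Algebra F D] [FiniteDimensional F D] {m : ℕ}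
variable {A : Subalgebra 𝒪[F] (Matrix (Fin m) (Fin m) D)} {e : ℕ} {ϖ : F}

variable (A e ϖ) in
/-- The norm on the column space attached to the chain of `A`, given by its balls
`{w | norm w ≥ s}` in additive notation. -/
def chainBall (s : ℝ) : Submodule A (Fin m → D) := chain A e ϖ ⌈e * s⌉

lemma chainBall_div (hpos : 0 < e) (n : ℤ) : chainBall A e ϖ ((n : ℝ) / e) = chain A e ϖ n := by
  rw [chainBall, mul_div_cancel₀ _ (by exact_mod_cast hpos.ne'), Int.ceil_intCast]

lemma IsHereditaryOrder.rightMul_mem_chainBall (hA : IsHereditaryOrder F A) (hm : 0 < m)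
    (he : IsRamificationIndex F A e) (hϖ : ordF F ϖ = 1) {w : Fin m → D} {s t : ℝ}
    {d : D} (hw : w ∈ chainBall A e ϖ s) (hd : d ∈ ball F t) :
    rightMul A d w ∈ chainBall A e ϖ (s + t) := by
  obtain rfl | h0 := eq_or_ne d 0
  · have hzero : rightMul A (0 : D) w = 0 := funext fun i => mul_zero (w i)
    rw [hzero]
    exact zero_mem _
  obtain ⟨c, hc, hshift⟩ := hA.map_rightMul_chain hm he hϖ h0
  refine chain_antitone he (he.pos hA hm) hϖ ?_ (hshift _ ▸ Submodule.mem_map_of_mem hw)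
  rw [← Int.ceil_add_intCast, hc, ← mul_add]
  have := (mem_ball_of_ne_zero h0).1 hd
  gcongr

lemma IsHereditaryOrder.exists_greatest_mem_chain (hA : IsHereditaryOrder F A)
    (hpos : 0 < e) (hϖ : ordF F ϖ = 1) (i : Fin m) :
    ∃ n : ℤ, (∃ w ∈ chain A e ϖ n, w i = 1 ∧ ∀ j, i < j → w j = 0) ∧
      ∀ n', (∃ w ∈ chain A e ϖ n', w i = 1 ∧ ∀ j, i < j → w j = 0) → n' ≤ n := by
  obtain ⟨K, hK⟩ := hA.exists_forall_mem_ball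
  refine Int.exists_greatest_of_bdd ⟨e * (K + 1), fun n ⟨w, hw, hwi, _⟩ => ?_⟩ ?_
  · have hball := mem_ball_of_mem_chain hpos hϖ hK hw i
    rw [hwi, mem_ball_of_ne_zero one_ne_zero, valD_one, sub_nonpos,
      div_le_iff₀' (by exact_mod_cast hpos)] at hball
    exact_mod_cast hball
  · obtain ⟨n, hn⟩ := exists_mem_chain (A := A) hpos hϖ (Pi.single i 1)
    exact ⟨n, _, hn, Pi.single_eq_same _ _, fun j hj => Pi.single_eq_of_ne hj.ne' _⟩

lemma IsHereditaryOrder.exists_mem_chainBall_forall_mem_ball (hA : IsHereditaryOrder F A)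
    (hm : 0 < m) (he : IsRamificationIndex F A e) (hϖ : ordF F ϖ = 1) (i : Fin m) :
    ∃ (w : Fin m → D) (y : ℝ), w ∈ chainBall A e ϖ y ∧ w i = 1 ∧ (∀ j, i < j → w j = 0) ∧
      ∀ v s, v ∈ chainBall A e ϖ s → (∀ j, i < j → v j = 0) → v i ∈ ball F (s - y) := by
  have hpos := he.pos hA hm
  obtain ⟨n, ⟨w, hw, hwi, hw0⟩, hmax⟩ := hA.exists_greatest_mem_chain hpos hϖ i
  refine ⟨w, n / e, by rwa [chainBall_div hpos], hwi, hw0, fun v s hv hv0 => ?_⟩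
  obtain h0 | h0 := eq_or_ne (v i) 0
  · rw [h0]
    exact zero_mem _
  have hle := hmax _ ⟨_, hA.rightMul_mem_chainBall hm he hϖ hv (.inr le_rfl : (v i)⁻¹ ∈ ball F _),
    mul_inv_cancel₀ h0, fun j hj => by rw [rightMul_apply, hv0 j hj, zero_mul]⟩
  rw [Int.ceil_le, valD_inv h0, ← sub_eq_add_neg,
    ← le_div_iff₀' (by exact_mod_cast hpos)] at hle
  exact (mem_ball_of_ne_zero h0).2 (by linarith)

variable (A e ϖ) in
/-- The columns `w_i` of `g` form a splitting basis for the norm of `chainBall`, that is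
`norm (∑ w_i u_i) = min (v(u_i) + x_i)`. -/
def IsSplitting (g : Matrix (Fin m) (Fin m) D) (x : Fin m → ℝ) : Prop :=
  ∀ s u, g • u ∈ chainBall A e ϖ s ↔ ∀ i, u i ∈ ball F (s - x i)

/-- Gram-Schmidt: the `i`-th vector of the basis is of greatest norm among those with `i`-th
coordinate `1` and later coordinates `0`. -/
lemma IsHereditaryOrder.exists_isSplitting (hA : IsHereditaryOrder F A) (hm : 0 < m)
    (he : IsRamificationIndex F A e) (hϖ : ordF F ϖ = 1) : ∃ g x, IsSplitting A e ϖ g x := by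
  choose w y hwy hw1 hw0 hball using
    hA.exists_mem_chainBall_forall_mem_ball (D := D) (ϖ := ϖ) hm he hϖ
  refine ⟨Matrix.of fun j i => w i j, y, fun s u => ?_⟩
  have hsmul : (Matrix.of fun j i => w i j : Matrix (Fin m) (Fin m) D) • u =
      ∑ i, rightMul A (u i) (w i) := funext fun j =>
    (Finset.sum_apply j Finset.univ fun i => rightMul A (u i) (w i)).symm
  have hmem : ∀ i, u i ∈ ball F (s - y i) → rightMul A (u i) (w i) ∈ chainBall A e ϖ s :=
    fun i hi => by simpa only [add_sub_cancel] using hA.rightMul_mem_chainBall hm he hϖ (hwy i) hi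
  rw [hsmul]
  refine ⟨fun hsum i => ?_, fun h => Submodule.sum_mem _ fun i _ => hmem i (h i)⟩
  induction i using WellFoundedGT.induction with
  | ind i ih =>
    rw [← Finset.sum_filter_add_sum_filter_not _ (· ≤ i)] at hsum
    have hle := (Submodule.add_mem_iff_left _ (Submodule.sum_mem _ fun j hj =>
      hmem j (ih j (not_le.1 (Finset.mem_filter.1 hj).2)))).1 hsum
    have hcoord : (∑ l with l ≤ i, rightMul A (u l) (w l)) i = u i := by
      rw [Finset.sum_apply, Finset.sum_eq_single i, rightMul_apply, hw1, one_mul]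
      · intro l hl hli
        rw [rightMul_apply, hw0 l i ((Finset.mem_filter.1 hl).2.lt_of_ne hli), zero_mul]
      · exact fun h => (h (Finset.mem_filter.2 ⟨Finset.mem_univ i, le_rfl⟩)).elim
    rw [← hcoord]
    refine hball i _ s hle fun j hj => ?_
    rw [Finset.sum_apply]
    exact Finset.sum_eq_zero fun l hl => by
      rw [rightMul_apply, hw0 l j ((Finset.mem_filter.1 hl).2.trans_lt hj), zero_mul]

lemma IsSplitting.isUnit {g : Matrix (Fin m) (Fin m) D} {x : Fin m → ℝ}
    (h : IsSplitting A e ϖ g x) : IsUnit g := by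
  refine isUnit_of_forall_smul_eq_zero fun u hu => funext fun i => by_contra fun h0 => ?_
  have hball := (h (valD F (u i) + x i + 1) u).1 (hu ▸ zero_mem _) i
  rw [mem_ball_of_ne_zero h0] at hball
  linarith

lemma IsSplitting.conj_smul_mem_chainBall {g : GLD D m} {x : Fin m → ℝ}
    (h : IsSplitting A e ϖ (g : Matrix (Fin m) (Fin m) D) x) {s t : ℝ}
    {a : Matrix (Fin m) (Fin m) D} (ha : a ∈ matBall F x s) {w : Fin m → D}
    (hw : w ∈ chainBall A e ϖ t) :
    ((g : Matrix (Fin m) (Fin m) D) * a * ((g⁻¹ : GLD D m) : Matrix (Fin m) (Fin m) D)) • w ∈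
      chainBall A e ϖ (s + t) := by
  obtain ⟨u, rfl⟩ : ∃ u, w = (g : Matrix (Fin m) (Fin m) D) • u :=
    ⟨((g⁻¹ : GLD D m) : Matrix (Fin m) (Fin m) D) • w, by
      rw [smul_smul, Units.mul_inv, one_smul]⟩
  rw [smul_smul, Units.inv_mul_cancel_right, mul_smul, h]
  rw [h] at hw
  refine fun i => AddSubgroup.sum_mem _ fun l _ => ?_
  rw [smul_eq_mul]
  convert mul_mem_ball (ha i l) (hw l) using 2
  ring

lemma IsHereditaryOrder.exists_moyPrasadPlus_subset (hA : IsHereditaryOrder F A) (hm : 0 < m)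
    (he : IsRamificationIndex F A e) (j : ℕ) : ∃ (g : GLD D m) (x : Fin m → ℝ),
      moyPrasadPlus F D g x ((j : ℝ) / e) ⊆ unitFiltration F A (j + 1) := by
  obtain ⟨ϖ, -, hϖ⟩ := exists_ordF_eq F 1
  have hpos := he.pos hA hm
  have he0 : (0 : ℝ) < e := by exact_mod_cast hpos
  obtain ⟨_, x, h⟩ := hA.exists_isSplitting hm he hϖ
  obtain ⟨g, rfl⟩ := h.isUnit
  refine ⟨g, x, fun γ hγ => ?_⟩
  obtain ⟨s, hs, hγs⟩ := Set.mem_iUnion₂.1 hγ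
  have ha := (mem_moyPrasadStd_iff ((by positivity : (0 : ℝ) ≤ j / e).trans_lt hs)).1
    (mem_moyPrasad_iff.1 hγs)
  obtain ⟨b, hb, hbγ⟩ := hA.exists_mem_jacobson_pow_of_smul_mem_chain hm he hϖ (k := j + 1)
    fun n w hw => by
      rw [← chainBall_div hpos] at hw
      refine chain_antitone he hpos hϖ ?_ (h.conj_smul_mem_chainBall ha hw)
      have hjs : (j : ℤ) < ⌈e * s⌉ := Int.lt_ceil.2 (by exact_mod_cast (div_lt_iff₀' he0).1 hs)
      rw [mul_add, mul_div_cancel₀ _ he0.ne', Int.ceil_add_intCast]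
      push_cast
      omega
  refine ⟨b, hb, ?_⟩
  rw [hbγ, Units.val_mul, Units.val_mul, mul_sub, sub_mul, mul_one, Units.mul_inv, mul_assoc,
    mul_assoc, Units.mul_inv, mul_one, Units.mul_inv_cancel_left, add_sub_cancel]

end Splitting

section DepthOfSubgroup

variable {F : Type*} [Field F] [ValuativeRel F] [TopologicalSpace F]
  [IsNonarchimedeanLocalField F]
variable {D : Type*} [DivisionRing D] [Algebra F D] {m : ℕ} {H : Subgroup (GLD D m)}
variable {V : Type*} [AddCommGroup V] [Module ℂ V] {π : Representation ℂ H V}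

lemma HasFixedVector.mono {K K' : Set (GLD D m)} (h : HasFixedVector π K) (hK : K' ⊆ K) :
    HasFixedVector π K' :=
  let ⟨v, hv, hfix⟩ := h
  ⟨v, hv, fun g hg => hfix g (hK hg)⟩

variable (F π) in
/-- The set whose least element is the Moy-Prasad depth, for a representation of an arbitrary
subgroup of `GL_m(D)`. -/
def moyPrasadSetOfSubgroup : Set ℝ :=
  {r | 0 ≤ r ∧ ∃ (g : GLD D m) (x : Fin m → ℝ), HasFixedVector π (moyPrasadPlus F D g x r)}

variable (F π) in
/-- The set whose least element is the normalized level, for a representation of an arbitrary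
subgroup of `GL_m(D)`. -/
def levelSetOfSubgroup : Set ℝ :=
  {s | ∃ (A : Subalgebra 𝒪[F] (Matrix (Fin m) (Fin m) D)) (e j : ℕ),
    IsHereditaryOrder F A ∧ IsRamificationIndex F A e ∧
    HasFixedVector π (unitFiltration F A (j + 1)) ∧ s = (j : ℝ) / (e : ℝ)}

variable [FiniteDimensional F D]

lemma levelSetOfSubgroup_subset (hm : 0 < m) :
    levelSetOfSubgroup F π ⊆ moyPrasadSetOfSubgroup F π := by
  rintro _ ⟨A, e, j, hA, he, hfix, rfl⟩
  obtain ⟨g, x, hsub⟩ := hA.exists_moyPrasadPlus_subset hm he j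
  exact ⟨by positivity, g, x, hfix.mono hsub⟩

variable (F D m) in
lemma exists_natCast_div_mem_levelSetOfSubgroup_le (hm : 0 < m) :
    ∃ N : ℕ, 0 < N ∧ ∀ {H : Subgroup (GLD D m)} {V : Type*} [AddCommGroup V] [Module ℂ V]
      (π : Representation ℂ H V), ∀ r ∈ moyPrasadSetOfSubgroup F π,
        ∃ k : ℕ, (k : ℝ) / N ∈ levelSetOfSubgroup F π ∧ (k : ℝ) / N ≤ r := by
  obtain ⟨d, ϖ, hϖ⟩ := exists_isUniformizer F D
  refine ⟨m.factorial * d, Nat.mul_pos m.factorial_pos hϖ.pos, ?_⟩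
  rintro H V _ _ π r ⟨hr, g, x, hfix⟩
  obtain ⟨A, q, p, hq, hqm, hA, he, hsub, hle⟩ :=
    exists_isHereditaryOrder_unitFiltration_subset hm hϖ g x hr
  obtain ⟨c, hc⟩ := Nat.dvd_factorial hq hqm
  have hc0 : c ≠ 0 := right_ne_zero_of_mul (hc ▸ m.factorial_ne_zero)
  have hfrac : ((p * c : ℕ) : ℝ) / (m.factorial * d : ℕ) = (p : ℝ) / (q * d : ℕ) := by
    rw [hc, mul_right_comm, Nat.cast_mul, Nat.cast_mul (q * d),
      mul_div_mul_right _ _ (Nat.cast_ne_zero.2 hc0)]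
  refine ⟨p * c, ?_, hfrac ▸ hle⟩
  rw [hfrac]
  exact ⟨A, q * d, p, hA, he, hfix.mono hsub, rfl⟩

lemma exists_isLeast_moyPrasadSetOfSubgroup [TopologicalSpace D] [IsModuleTopology F D]
    [Nontrivial V] (hm : 0 < m) (hπ : IsSmooth π) :
    ∃ r, IsLeast (moyPrasadSetOfSubgroup F π) r ∧ IsLeast (levelSetOfSubgroup F π) r := by
  obtain ⟨N, _, hN⟩ := exists_natCast_div_mem_levelSetOfSubgroup_le F D m hm
  obtain ⟨r, hr0, hr⟩ := exists_hasFixedVector_moyPrasadPlus F hπ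
  obtain ⟨k, hk, _⟩ := hN π r ⟨hr0, 1, 0, hr⟩
  classical
  have hex : ∃ k : ℕ, (k : ℝ) / N ∈ levelSetOfSubgroup F π := ⟨k, hk⟩
  have hsub := levelSetOfSubgroup_subset (F := F) (π := π) hm
  have hlower : (Nat.find hex : ℝ) / N ∈ lowerBounds (moyPrasadSetOfSubgroup F π) :=
    fun r hr => by
      obtain ⟨k, hk, hkr⟩ := hN π r hr
      have : (Nat.find hex : ℝ) ≤ k := by exact_mod_cast Nat.find_min' hex hk
      exact le_trans (by gcongr) hkr
  have hmem := Nat.find_spec hex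
  exact ⟨_, ⟨hsub hmem, hlower⟩, hmem, fun s hs => hlower (hsub hs)⟩

lemma nontrivial_of_isIrreducible {k G V : Type*} [Field k] [Monoid G] [AddCommGroup V]
    [Module k V] {ρ : Representation k G V} (hρ : ρ.IsIrreducible) : Nontrivial V :=
  have : IsSimpleModule (MonoidAlgebra k G) ρ.asModule :=
    ρ.irreducible_iff_isSimpleModule_asModule.1 hρ
  IsSimpleModule.nontrivial (MonoidAlgebra k G) ρ.asModule

end DepthOfSubgroup

end InnerFormSL

end

theorem mainTheorem11_general
    (F : Type*) [Field F] [ValuativeRel F] [TopologicalSpace F] [IsNonarchimedeanLocalField F]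
    (D : Type*) [DivisionRing D] [Algebra F D] [FiniteDimensional F D]
    [TopologicalSpace D] [IsModuleTopology F D]
    (m : ℕ) (hm : 0 < m) (H : Subgroup (InnerFormSL.GLD D m))
    (V : Type*) [AddCommGroup V] [Module ℂ V] [Nontrivial V]
    (π : Representation ℂ H V) (hsmooth : InnerFormSL.IsSmooth π) :
    IsLeast (InnerFormSL.moyPrasadSetOfSubgroup F π)
        (sInf (InnerFormSL.moyPrasadSetOfSubgroup F π)) ∧
      IsLeast (InnerFormSL.levelSetOfSubgroup F π) (sInf (InnerFormSL.levelSetOfSubgroup F π)) ∧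
      sInf (InnerFormSL.moyPrasadSetOfSubgroup F π) =
        sInf (InnerFormSL.levelSetOfSubgroup F π) := by
  obtain ⟨r, hM, hL⟩ := InnerFormSL.exists_isLeast_moyPrasadSetOfSubgroup (F := F) hm hsmooth
  rw [hM.csInf_eq, hL.csInf_eq]
  exact ⟨hM, hL, rfl⟩

theorem mainTheorem11
    (F : Type*) [Field F] [ValuativeRel F] [TopologicalSpace F] [IsNonarchimedeanLocalField F]
    (D : Type*) [DivisionRing D] [Algebra F D] [FiniteDimensional F D] [Algebra.IsCentral F D]
    [TopologicalSpace D] [IsModuleTopology F D]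
    (m : ℕ) (hm : 0 < m)
    (V : Type*) [AddCommGroup V] [Module ℂ V]
    (π : Representation ℂ (InnerFormSL.derivedGL F D m) V)
    (hsmooth : InnerFormSL.IsSmooth π) (hirr : π.IsIrreducible) :
    IsLeast (InnerFormSL.moyPrasadSet F π) (InnerFormSL.moyPrasadDepth F π) ∧
      IsLeast (InnerFormSL.levelSet F π) (InnerFormSL.normalizedLevel F π) ∧
      InnerFormSL.moyPrasadDepth F π = InnerFormSL.normalizedLevel F π := by
  have : Nontrivial V := InnerFormSL.nontrivial_of_isIrreducible hirr
  exact mainTheorem11_general F D m hm (InnerFormSL.derivedGL F D m) V π hsmooth
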